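/- **Setting.** Let $G=(V,E)$ be a graph on $V=\{1,\dots,p\}$ in which every node has degree at most $d$, where $d\ge 1$, and let $0<\alpha\le\beta$, $h\ge 0$. The Ising model on $G$ with couplings $\theta_{ij}=\theta_{ji}$, $\alpha\le|\theta_{ij}|\le\beta$ for $\{i,j\}\in E$, $\theta_{ij}=0$ for $\{i,j\}\notin E$, and fields $|\theta_i|\le h$ is the law on $\{-1,+1\}^V$ with $$P(x)\propto\exp\Big(\sum_{\{i,j\}\in E}\theta_{ij}x_ix_j+\sum_{i\in V}\theta_ix_i\Big).$$ Given samples $X^{(1)},\dots,X^{(n)}\in\{-1,+1\}^V$, let $\widehat P$ be their empirical distribution (conditional probabilities given events of empirical probability $0$ are read as $0$). For $u\in V$, $S\subseteq V$ and $i\notin S\cup\{u\}$ let $$\widehat\nu_{u|i;x_S}=\widehat P(X_u=+\mid X_i=+,X_S=x_S)-\widehat P(X_u=+\mid X_i=-,X_S=x_S),$$ $$\widehat\lambda_i(x_S)=2\,\widehat P(X_i=+\mid X_S=x_S)\,\widehat P(X_i=-\mid X_S=x_S),\qquad \widehat\nu^{\rm avg}_{u|i;S}=\frac1n\sum_{t=1}^n\widehat\lambda_i(X^{(t)}_S)\,\big|\widehat\nu_{u|i;X^{(t)}_S}\big|,$$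 and put $\widehat\nu^{\rm avg}_{u|i;S}=0$ if $i\in S\cup\{u\}$. The algorithm LearnNbhd$(X^{(1)},\dots,X^{(n)},\tau,u)$ starts with $S=\varnothing$; as long as $\max_i\widehat\nu^{\rm avg}_{u|i;S}\ge\tau$ it adds a maximizer $i$ to $S$ (ties broken arbitrarily); then, for each element $i$ of the resulting set, in any order, it removes $i$ from the current set $S$ if $\widehat\nu^{\rm avg}_{u|i;S\setminus\{i\}}<\tau$; it outputs $S$. Running time is the number of steps on a random access machine with unit-cost arithmetic on real numbers: programs are built from elementary instructions by sequencing, branching and while loops, every elementary instruction and every test costs one step, natural-number registers can be added, subtracted and compared, real registers can be added, subtracted, multiplied, divided and compared, and the entries of the sample matrix and of arrays are accessed in one step. Let $$\delta=\tfrac12e^{-2(\beta d+h)},\quad \tau^*=\frac{\alpha^2\delta^{4d+1}}{16d\beta},\quad \epsilon^*=\frac{\tau^*}2,\quad \ell^*=\frac8{(\tau^*)^2},\quad N(p)=\frac{144(\ell^*+3)}{(\epsilon^*)^2\delta^{2\ell^*}}\log\frac p\zeta .$$ **Theorem.** There are a program that implements LearnNbhd (for all $p,n$, all samples, all $u$ and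 all $\tau>0$ it halts with a possible output of LearnNbhd) and numerical constants $C,c,c',c''>0$ such that for all $d\ge1$, $0<\alpha\le\beta$, $h\ge0$ and $\zeta>0$ the following hold. 1. $\displaystyle\frac{144(\ell^*+3)}{(\epsilon^*)^2\delta^{2\ell^*}}\le\exp\big\{c\,\alpha^{-c'}e^{c''d(\beta d+h+1)}\big\}$. 2. For all $p$, $n$, $G$ and $\theta$ as above with $n\ge N(p)$, if $X^{(1)},\dots,X^{(n)}$ are i.i.d. samples from the Ising model, then with probability at least $1-\zeta$, for every node $u$: LearnNbhd$(X^{(1)},\dots,X^{(n)},\tau^*,u)$ returns exactly the neighborhood of $u$ (however ties are broken), and the running time of the program on this input is at most $C\ell^*pn$. 3. There is a constant $K$, depending only on $d,\alpha,\beta,h,\zeta$, such that for all $p\ge2$, $n=\lceil N(p)\rceil$ (read as $0$ if $N(p)<0$), $G$ and $\theta$ as above, with probability at least $1-\zeta$ all neighborhoods are returned correctly, the running time is at most $K\,p\log p$ for each node, and at most $K\,p^2\log p$ in total over all nodes. -/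

import Mathlib

open MeasureTheory

namespace IsingLearn

/-! ### The Ising model -/

/-- A spin configuration; `true` stands for `+1` and `false` for `-1`. -/
abbrev Config (p : ℕ) : Type := Fin p → Bool

/-- `n` observed configurations. -/
abbrev Samples (p n : ℕ) : Type := Fin n → Config p

/-- The numerical value of a spin. -/
def spin (b : Bool) : ℝ := if b then 1 else -1

/-- A parameter vector: symmetric couplings `θ_{ij}` and external fields `θ_i`. -/
structure Param (p : ℕ) where
  coupling : Fin p → Fin p → ℝ
  symm : ∀ i j, coupling i j = coupling j i
  field : Fin p → ℝ

/-- `θ ∈ Ω_{α,β,h}(G)`. -/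
structure Param.Valid {p : ℕ} (θ : Param p) (G : SimpleGraph (Fin p)) (α β h : ℝ) : Prop where
  field_le : ∀ i, |θ.field i| ≤ h
  coupling_ge : ∀ i j, G.Adj i j → α ≤ |θ.coupling i j|
  coupling_le : ∀ i j, G.Adj i j → |θ.coupling i j| ≤ β
  coupling_eq_zero : ∀ i j, ¬ G.Adj i j → θ.coupling i j = 0

/-- `∑_{i<j} θ_{ij} x_i x_j + ∑_i θ_i x_i`. -/
noncomputable def Param.energy {p : ℕ} (θ : Param p) (x : Config p) : ℝ :=
  (∑ q : Fin p × Fin p with q.1 < q.2, θ.coupling q.1 q.2 * (spin (x q.1) * spin (x q.2)))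
    + ∑ i, θ.field i * spin (x i)

/-- The partition function `exp Φ(θ)`. -/
noncomputable def Param.partition {p : ℕ} (θ : Param p) : ℝ :=
  ∑ x : Config p, Real.exp (θ.energy x)

theorem Param.partition_pos {p : ℕ} (θ : Param p) : 0 < θ.partition :=
  Finset.sum_pos (fun x _ => Real.exp_pos (θ.energy x)) Finset.univ_nonempty

/-- The probability mass function of the Ising model. -/
noncomputable def Param.pmf {p : ℕ} (θ : Param p) : PMF (Config p) :=
  PMF.ofFintype (fun x => ENNReal.ofReal (Real.exp (θ.energy x) / θ.partition)) (by
    rw [← ENNReal.ofReal_sum_of_nonneg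
      (fun x _ => div_nonneg (Real.exp_pos _).le θ.partition_pos.le), ← Finset.sum_div]
    have h : (∑ x : Config p, Real.exp (θ.energy x)) / θ.partition = 1 :=
      div_self θ.partition_pos.ne'
    rw [h, ENNReal.ofReal_one])

/-- The joint law of `n` independent samples from the Ising model. -/
noncomputable def Param.sampleLaw {p : ℕ} (θ : Param p) (n : ℕ) : Measure (Samples p n) :=
  Measure.pi fun _ : Fin n => θ.pmf.toMeasure

/-! ### Empirical influences -/

section Empirical

variable {p n : ℕ}

/-- The expectation of `f` under the empirical measure. -/
noncomputable def empMean (X : Samples p n) (f : Config p → ℝ) : ℝ :=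
  (1 / (n : ℝ)) * ∑ t, f (X t)

/-- The empirical probability of an event. -/
noncomputable def empProb (X : Samples p n) (A : Set (Config p)) : ℝ :=
  empMean X (A.indicator 1)

/-- The empirical conditional probability of `A` given `B`. It is `0` if `B` has empirical
probability `0`; in `empInfluence` such terms have weight `empWeight = 0`. -/
noncomputable def empCond (X : Samples p n) (A B : Set (Config p)) : ℝ :=
  empProb X (A ∩ B) / empProb X B

/-- The event that the spin at `i` equals `b`. -/
def spinEvent (i : Fin p) (b : Bool) : Set (Config p) := {y | y i = b}

/-- The event that the configuration agrees with `x` on `S`. -/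
def agreeEvent (S : Finset (Fin p)) (x : Config p) : Set (Config p) := {y | ∀ j ∈ S, y j = x j}

/-- The empirical conditional influence of `i` on `u` given `X_S = x_S`. -/
noncomputable def empNu (X : Samples p n) (u i : Fin p) (S : Finset (Fin p)) (x : Config p) : ℝ :=
  empCond X (spinEvent u true) (spinEvent i true ∩ agreeEvent S x)
    - empCond X (spinEvent u true) (spinEvent i false ∩ agreeEvent S x)

/-- The weight `2 P̂(X_i = + | X_S = x_S) P̂(X_i = - | X_S = x_S)`. -/
noncomputable def empWeight (X : Samples p n) (i : Fin p) (S : Finset (Fin p)) (x : Config p) : ℝ :=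
  2 * empCond X (spinEvent i true) (agreeEvent S x) * empCond X (spinEvent i false) (agreeEvent S x)

/-- The empirical average conditional influence of `i` on `u` given `S`, set to `0` if
`i ∈ S ∪ {u}`. -/
noncomputable def empInfluence (X : Samples p n) (u i : Fin p) (S : Finset (Fin p)) : ℝ :=
  if i ∈ insert u S then 0
  else empMean X fun x => empWeight X i S x * |empNu X u i S x|

/-! ### The algorithm

Ties in the maximization and the order of the pruning loop are left open: the algorithm is a
relation between inputs and possible outputs. -/

/-- The sets that the greedy phase can build, starting from `∅` and adding a node of maximal
empirical influence as long as that influence is at least `τ`. -/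
inductive GreedyReach (X : Samples p n) (τ : ℝ) (u : Fin p) : Finset (Fin p) → Prop
  | empty : GreedyReach X τ u ∅
  | add (S : Finset (Fin p)) (i : Fin p) : GreedyReach X τ u S →
      (∀ j, empInfluence X u j S ≤ empInfluence X u i S) → τ ≤ empInfluence X u i S →
      GreedyReach X τ u (insert i S)

/-- `S` is a possible result of the pseudo-neighborhood phase: it has been built greedily, and no
influence reaches the threshold any more. -/
def PseudoNbhd (X : Samples p n) (τ : ℝ) (u : Fin p) (S : Finset (Fin p)) : Prop :=
  GreedyReach X τ u S ∧ ∀ i, empInfluence X u i S < τ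

/-- One pruning step: remove `i` from the current set `S` if its influence given `S \ {i}` is
below the threshold. -/
noncomputable def pruneStep (X : Samples p n) (τ : ℝ) (u : Fin p) (S : Finset (Fin p)) (i : Fin p) :
    Finset (Fin p) :=
  if empInfluence X u i (S.erase i) < τ then S.erase i else S

/-- `LearnNbhd X τ u R`: the set `R` is a possible output of the algorithm on the samples `X`, the
threshold `τ` and the node `u`. The list `l` is the order in which the pruning loop runs through the
pseudo-neighborhood. -/
def LearnNbhd (X : Samples p n) (τ : ℝ) (u : Fin p) (R : Finset (Fin p)) : Prop :=
  ∃ (S : Finset (Fin p)) (l : List (Fin p)), PseudoNbhd X τ u S ∧ l.Nodup ∧ l.toFinset = S ∧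
    R = l.foldl (pruneStep X τ u) S

end Empirical

/-! ### A random access machine with real arithmetic

Programs are structured (sequence, branching, `while` loops) and act on registers and arrays of
natural numbers (for counters and addresses) and of real numbers. Every elementary instruction and
every test costs one step. Natural numbers are only added, subtracted and compared; real numbers are
added, subtracted, multiplied, divided and compared, and a natural number can be converted to a
real number, but not conversely. -/

/-- The memory. -/
structure Store where
  nat : ℕ → ℕ
  arr : ℕ → ℕ → ℕ
  real : ℕ → ℝ
  rarr : ℕ → ℕ → ℝ

/-- Elementary instructions; the arguments are names of registers and arrays, apart from the
literal `k` in `const`. -/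
inductive Op
  /-- `nat[x] := k` -/
  | const (x k : ℕ)
  /-- `nat[x] := nat[y] + nat[z]` -/
  | add (x y z : ℕ)
  /-- `nat[x] := nat[y] - nat[z]` (truncated) -/
  | sub (x y z : ℕ)
  /-- `nat[x] := arr[a][nat[y]]` -/
  | load (x a y : ℕ)
  /-- `arr[a][nat[y]] := nat[x]` -/
  | store (a y x : ℕ)
  /-- `nat[x] :=` entry `(nat[y], nat[z])` of the input matrix -/
  | input (x y z : ℕ)
  /-- `real[r] := nat[x]` -/
  | cast (r x : ℕ)
  /-- `real[r] := real[a] + real[b]` -/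
  | radd (r a b : ℕ)
  /-- `real[r] := real[a] - real[b]` -/
  | rsub (r a b : ℕ)
  /-- `real[r] := real[a] * real[b]` -/
  | rmul (r a b : ℕ)
  /-- `real[r] := real[a] / real[b]` -/
  | rdiv (r a b : ℕ)
  /-- `real[r] := rarr[a][nat[y]]` -/
  | rload (r a y : ℕ)
  /-- `rarr[a][nat[y]] := real[r]` -/
  | rstore (a y r : ℕ)

/-- The effect of an elementary instruction; `D` is the read-only input matrix. -/
noncomputable def Op.apply (D : ℕ → ℕ → ℕ) (s : Store) : Op → Store
  | const x k => { s with nat := Function.update s.nat x k }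
  | add x y z => { s with nat := Function.update s.nat x (s.nat y + s.nat z) }
  | sub x y z => { s with nat := Function.update s.nat x (s.nat y - s.nat z) }
  | load x a y => { s with nat := Function.update s.nat x (s.arr a (s.nat y)) }
  | store a y x =>
      { s with arr := Function.update s.arr a (Function.update (s.arr a) (s.nat y) (s.nat x)) }
  | input x y z => { s with nat := Function.update s.nat x (D (s.nat y) (s.nat z)) }
  | cast r x => { s with real := Function.update s.real r (s.nat x : ℝ) }
  | radd r a b => { s with real := Function.update s.real r (s.real a + s.real b) }
  | rsub r a b => { s with real := Function.update s.real r (s.real a - s.real b) }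
  | rmul r a b => { s with real := Function.update s.real r (s.real a * s.real b) }
  | rdiv r a b => { s with real := Function.update s.real r (s.real a / s.real b) }
  | rload r a y => { s with real := Function.update s.real r (s.rarr a (s.nat y)) }
  | rstore a y r =>
      { s with rarr := Function.update s.rarr a (Function.update (s.rarr a) (s.nat y) (s.real r)) }

/-- Elementary tests on registers. -/
inductive Test
  | natLt (x y : ℕ)
  | natEq (x y : ℕ)
  | realLt (a b : ℕ)

/-- The truth value of a test. -/
def Test.Holds (s : Store) : Test → Prop
  | natLt x y => s.nat x < s.nat y
  | natEq x y => s.nat x = s.nat y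
  | realLt a b => s.real a < s.real b

/-- Programs. -/
inductive Prog
  | skip
  | op (o : Op)
  | seq (c₁ c₂ : Prog)
  | ite (b : Test) (c₁ c₂ : Prog)
  | loop (b : Test) (c : Prog)

/-- `Run D c s t s'`: with input matrix `D`, the program `c` started in the memory `s` halts after
exactly `t` steps in the memory `s'`; `loop b c` is `while b do c`. -/
inductive Run (D : ℕ → ℕ → ℕ) : Prog → Store → ℕ → Store → Prop
  | skip (s : Store) : Run D .skip s 1 s
  | op (o : Op) (s : Store) : Run D (.op o) s 1 (o.apply D s)
  | seq {c₁ c₂ : Prog} {s s₁ s₂ : Store} {t₁ t₂ : ℕ} : Run D c₁ s t₁ s₁ → Run D c₂ s₁ t₂ s₂ →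
      Run D (.seq c₁ c₂) s (t₁ + t₂) s₂
  | ite_true {b : Test} {c₁ c₂ : Prog} {s s' : Store} {t : ℕ} : b.Holds s → Run D c₁ s t s' →
      Run D (.ite b c₁ c₂) s (t + 1) s'
  | ite_false {b : Test} {c₁ c₂ : Prog} {s s' : Store} {t : ℕ} : ¬ b.Holds s → Run D c₂ s t s' →
      Run D (.ite b c₁ c₂) s (t + 1) s'
  | loop_true {b : Test} {c : Prog} {s s₁ s₂ : Store} {t₁ t₂ : ℕ} : b.Holds s → Run D c s t₁ s₁ →
      Run D (.loop b c) s₁ t₂ s₂ → Run D (.loop b c) s (t₁ + t₂ + 1) s₂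
  | loop_false {b : Test} {c : Prog} {s : Store} : ¬ b.Holds s → Run D (.loop b c) s 1 s

/-- The samples as input matrix: entry `(t, i)` is `1` if the `t`-th sample has spin `+` at node
`i`, and `0` otherwise. -/
def inputMatrix {p n : ℕ} (X : Samples p n) (t i : ℕ) : ℕ :=
  if h : t < n ∧ i < p then (if X ⟨t, h.1⟩ ⟨i, h.2⟩ then 1 else 0) else 0

/-- The initial memory: `p`, `n`, `u` in the first three natural registers, `τ` in the first real
register, and zeros elsewhere. -/
noncomputable def initStore (p n : ℕ) (τ : ℝ) (u : Fin p) : Store where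
  nat := fun x => if x = 0 then p else if x = 1 then n else if x = 2 then (u : ℕ) else 0
  arr := fun _ _ => 0
  real := fun r => if r = 0 then τ else 0
  rarr := fun _ _ => 0

/-- On the samples `X`, the threshold `τ` and the node `u`, the program `c` halts after exactly `t`
steps, and the first `p` cells of array `0` then hold the indicator function of `R`. -/
def Returns {p n : ℕ} (c : Prog) (X : Samples p n) (τ : ℝ) (u : Fin p) (t : ℕ)
    (R : Finset (Fin p)) : Prop :=
  ∃ s : Store, Run (inputMatrix X) c (initStore p n τ u) t s ∧
    ∀ j : Fin p, s.arr 0 (j : ℕ) = if j ∈ R then 1 else 0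

/-! ### The constants -/

/-- `δ = e^{-2(βd+h)} / 2`. -/
noncomputable def delta (d : ℕ) (β h : ℝ) : ℝ := 1 / 2 * Real.exp (-2 * (β * d + h))

/-- `τ* = α² δ^{4d+1} / (16 d β)`. -/
noncomputable def tauStar (d : ℕ) (α β h : ℝ) : ℝ :=
  α ^ 2 * delta d β h ^ (4 * d + 1) / (16 * d * β)

/-- `ε* = τ* / 2`. -/
noncomputable def epsStar (d : ℕ) (α β h : ℝ) : ℝ := tauStar d α β h / 2

/-- `ℓ* = 8 / (τ*)²`. -/
noncomputable def ellStar (d : ℕ) (α β h : ℝ) : ℝ := 8 / tauStar d α β h ^ 2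

/-- `144 (ℓ* + 3) / ((ε*)² δ^{2ℓ*})`. -/
noncomputable def sampleCoeff (d : ℕ) (α β h : ℝ) : ℝ :=
  144 * (ellStar d α β h + 3) /
    (epsStar d α β h ^ 2 * delta d β h ^ (2 * ellStar d α β h))

/-- The number of samples that suffices: `144 (ℓ* + 3) / ((ε*)² δ^{2ℓ*}) · log (p / ζ)`. -/
noncomputable def sampleBound (d : ℕ) (α β h ζ : ℝ) (p : ℕ) : ℝ :=
  sampleCoeff d α β h * Real.log (p / ζ)

end IsingLearn

open IsingLearn

namespace IsingLearn

/-! ### Reasoning about programs -/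

section OpLemmas

variable (D : ℕ → ℕ → ℕ) (s : Store) (x y z k a r b q j : ℕ)

theorem apply_const_nat : (Op.apply D s (.const x k)).nat j = if j = x then k else s.nat j := by
  simp only [Op.apply, Function.update_apply]
theorem apply_add_nat :
    (Op.apply D s (.add x y z)).nat j = if j = x then s.nat y + s.nat z else s.nat j := by
  simp only [Op.apply, Function.update_apply]
theorem apply_load_nat :
    (Op.apply D s (.load x a y)).nat j = if j = x then s.arr a (s.nat y) else s.nat j := by
  simp only [Op.apply, Function.update_apply]
theorem apply_store_nat : (Op.apply D s (.store a y x)).nat = s.nat := rfl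
theorem apply_input_nat :
    (Op.apply D s (.input x y z)).nat j = if j = x then D (s.nat y) (s.nat z) else s.nat j := by
  simp only [Op.apply, Function.update_apply]
theorem apply_cast_nat : (Op.apply D s (.cast r x)).nat = s.nat := rfl
theorem apply_radd_nat : (Op.apply D s (.radd r a b)).nat = s.nat := rfl
theorem apply_rsub_nat : (Op.apply D s (.rsub r a b)).nat = s.nat := rfl
theorem apply_rmul_nat : (Op.apply D s (.rmul r a b)).nat = s.nat := rfl
theorem apply_rdiv_nat : (Op.apply D s (.rdiv r a b)).nat = s.nat := rfl
theorem apply_rload_nat : (Op.apply D s (.rload r a y)).nat = s.nat := rfl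
theorem apply_rstore_nat : (Op.apply D s (.rstore a y r)).nat = s.nat := rfl

theorem apply_const_arr : (Op.apply D s (.const x k)).arr = s.arr := rfl
theorem apply_add_arr : (Op.apply D s (.add x y z)).arr = s.arr := rfl
theorem apply_load_arr : (Op.apply D s (.load x a y)).arr = s.arr := rfl
theorem apply_store_arr : (Op.apply D s (.store a y x)).arr q j =
    if q = a ∧ j = s.nat y then s.nat x else s.arr q j := by
  simp only [Op.apply, Function.update_apply]
  split_ifs <;> simp_all
theorem apply_input_arr : (Op.apply D s (.input x y z)).arr = s.arr := rfl
theorem apply_cast_arr : (Op.apply D s (.cast r x)).arr = s.arr := rfl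
theorem apply_radd_arr : (Op.apply D s (.radd r a b)).arr = s.arr := rfl
theorem apply_rsub_arr : (Op.apply D s (.rsub r a b)).arr = s.arr := rfl
theorem apply_rmul_arr : (Op.apply D s (.rmul r a b)).arr = s.arr := rfl
theorem apply_rdiv_arr : (Op.apply D s (.rdiv r a b)).arr = s.arr := rfl
theorem apply_rload_arr : (Op.apply D s (.rload r a y)).arr = s.arr := rfl
theorem apply_rstore_arr : (Op.apply D s (.rstore a y r)).arr = s.arr := rfl

theorem apply_const_real : (Op.apply D s (.const x k)).real = s.real := rfl
theorem apply_add_real : (Op.apply D s (.add x y z)).real = s.real := rfl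
theorem apply_load_real : (Op.apply D s (.load x a y)).real = s.real := rfl
theorem apply_store_real : (Op.apply D s (.store a y x)).real = s.real := rfl
theorem apply_input_real : (Op.apply D s (.input x y z)).real = s.real := rfl
theorem apply_cast_real : (Op.apply D s (.cast r x)).real j =
    if j = r then (s.nat x : ℝ) else s.real j := by
  simp only [Op.apply, Function.update_apply]
theorem apply_radd_real : (Op.apply D s (.radd r a b)).real j =
    if j = r then s.real a + s.real b else s.real j := by
  simp only [Op.apply, Function.update_apply]
theorem apply_rsub_real : (Op.apply D s (.rsub r a b)).real j =
    if j = r then s.real a - s.real b else s.real j := by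
  simp only [Op.apply, Function.update_apply]
theorem apply_rmul_real : (Op.apply D s (.rmul r a b)).real j =
    if j = r then s.real a * s.real b else s.real j := by
  simp only [Op.apply, Function.update_apply]
theorem apply_rdiv_real : (Op.apply D s (.rdiv r a b)).real j =
    if j = r then s.real a / s.real b else s.real j := by
  simp only [Op.apply, Function.update_apply]
theorem apply_rload_real : (Op.apply D s (.rload r a y)).real j =
    if j = r then s.rarr a (s.nat y) else s.real j := by
  simp only [Op.apply, Function.update_apply]
theorem apply_rstore_real : (Op.apply D s (.rstore a y r)).real = s.real := rfl

theorem apply_const_rarr : (Op.apply D s (.const x k)).rarr = s.rarr := rfl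
theorem apply_add_rarr : (Op.apply D s (.add x y z)).rarr = s.rarr := rfl
theorem apply_load_rarr : (Op.apply D s (.load x a y)).rarr = s.rarr := rfl
theorem apply_store_rarr : (Op.apply D s (.store a y x)).rarr = s.rarr := rfl
theorem apply_input_rarr : (Op.apply D s (.input x y z)).rarr = s.rarr := rfl
theorem apply_cast_rarr : (Op.apply D s (.cast r x)).rarr = s.rarr := rfl
theorem apply_radd_rarr : (Op.apply D s (.radd r a b)).rarr = s.rarr := rfl
theorem apply_rsub_rarr : (Op.apply D s (.rsub r a b)).rarr = s.rarr := rfl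
theorem apply_rmul_rarr : (Op.apply D s (.rmul r a b)).rarr = s.rarr := rfl
theorem apply_rdiv_rarr : (Op.apply D s (.rdiv r a b)).rarr = s.rarr := rfl
theorem apply_rload_rarr : (Op.apply D s (.rload r a y)).rarr = s.rarr := rfl
theorem apply_rstore_rarr : (Op.apply D s (.rstore a y r)).rarr q j =
    if q = a ∧ j = s.nat y then s.real r else s.rarr q j := by
  simp only [Op.apply, Function.update_apply]
  split_ifs <;> simp_all

end OpLemmas

attribute [simp] apply_const_nat apply_add_nat apply_load_nat apply_store_nat
  apply_input_nat apply_cast_nat apply_radd_nat apply_rsub_nat apply_rmul_nat apply_rdiv_nat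
  apply_rload_nat apply_rstore_nat apply_const_arr apply_add_arr apply_load_arr
  apply_store_arr apply_input_arr apply_cast_arr apply_radd_arr apply_rsub_arr apply_rmul_arr
  apply_rdiv_arr apply_rload_arr apply_rstore_arr apply_const_real apply_add_real
  apply_load_real apply_store_real apply_input_real apply_cast_real apply_radd_real
  apply_rsub_real apply_rmul_real apply_rdiv_real apply_rload_real apply_rstore_real
  apply_const_rarr apply_add_rarr apply_load_rarr apply_store_rarr
  apply_input_rarr apply_cast_rarr apply_radd_rarr apply_rsub_rarr apply_rmul_rarr
  apply_rdiv_rarr apply_rload_rarr apply_rstore_rarr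

/-- `c`, started in `s`, halts within `N` steps in a memory that satisfies `Q`. -/
def Halts (D : ℕ → ℕ → ℕ) (c : Prog) (s : Store) (N : ℕ) (Q : Store → Prop) : Prop :=
  ∃ t s', Run D c s t s' ∧ t ≤ N ∧ Q s'

/-- Straight-line code. -/
def block : List Op → Prog
  | [] => .skip
  | o :: l => .seq (.op o) (block l)

section Rules

variable {D : ℕ → ℕ → ℕ} {c c₁ c₂ : Prog} {s : Store} {N N₁ N₂ : ℕ} {Q R : Store → Prop}

theorem Halts.mono (h : Halts D c s N₁ Q) (hN : N₁ ≤ N₂) (hQ : ∀ s', Q s' → R s') :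
    Halts D c s N₂ R := by
  obtain ⟨t, s', h1, h2, h3⟩ := h
  exact ⟨t, s', h1, h2.trans hN, hQ _ h3⟩

theorem Halts.skip (h : Q s) : Halts D .skip s 1 Q := ⟨1, s, .skip s, le_rfl, h⟩

theorem Halts.op {o : Op} (h : Q (o.apply D s)) : Halts D (.op o) s 1 Q :=
  ⟨1, _, .op o s, le_rfl, h⟩

theorem Halts.seq (h₁ : Halts D c₁ s N₁ R) (h₂ : ∀ s', R s' → Halts D c₂ s' N₂ Q) :
    Halts D (.seq c₁ c₂) s (N₁ + N₂) Q := by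
  obtain ⟨t, s', h1, h2, h3⟩ := h₁
  obtain ⟨t', s'', h1', h2', h3'⟩ := h₂ s' h3
  exact ⟨t + t', s'', .seq h1 h1', add_le_add h2 h2', h3'⟩

theorem Halts.block {l : List Op} :
    ∀ {s : Store}, Q (l.foldl (fun s o => o.apply D s) s) →
      Halts D (block l) s (l.length + 1) Q := by
  induction l with
  | nil => intro s h; exact Halts.skip h
  | cons o l ih =>
    intro s h
    refine (Halts.seq (R := fun s' => s' = o.apply D s) (Halts.op rfl) (N₂ := l.length + 1)
      fun s' hs' => ?_).mono ?_ fun _ h => h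
    · subst hs'; exact ih h
    · simp only [List.length_cons]; omega

theorem Halts.ite {b : Test} (h₁ : b.Holds s → Halts D c₁ s N Q)
    (h₂ : ¬ b.Holds s → Halts D c₂ s N Q) : Halts D (.ite b c₁ c₂) s (N + 1) Q := by
  by_cases hb : b.Holds s
  · obtain ⟨t, s', h1, h2, h3⟩ := h₁ hb
    exact ⟨t + 1, s', .ite_true hb h1, by omega, h3⟩
  · obtain ⟨t, s', h1, h2, h3⟩ := h₂ hb
    exact ⟨t + 1, s', .ite_false hb h1, by omega, h3⟩

/-- The rule for counting loops: `x` is the counter and `y` holds the bound `m`. -/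
theorem Halts.loop {x y m : ℕ} (I : ℕ → Store → Prop) (cost : ℕ → ℕ)
    (hI : ∀ k s, I k s → s.nat x = k ∧ s.nat y = m)
    (hstep : ∀ k < m, ∀ s, I k s → Halts D c s (cost k) (I (k + 1))) (h0 : I 0 s) :
    Halts D (.loop (.natLt x y) c) s (∑ k ∈ Finset.range m, (cost k + 1) + 1) (I m) := by
  have key : ∀ j k s, j + k = m → I k s →
      Halts D (.loop (.natLt x y) c) s (∑ i ∈ Finset.Ico k m, (cost i + 1) + 1) (I m) := by
    intro j
    induction j with
    | zero =>
      intro k s hk hIk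
      obtain rfl : k = m := by omega
      refine ⟨1, s, .loop_false ?_, by omega, hIk⟩
      simp [Test.Holds, (hI _ _ hIk).1, (hI _ _ hIk).2]
    | succ j ih =>
      intro k s hk hIk
      have hkm : k < m := by omega
      obtain ⟨t, s', h1, h2, h3⟩ := hstep k hkm s hIk
      obtain ⟨t', s'', h1', h2', h3'⟩ := ih (k + 1) s' (by omega) h3
      refine ⟨t + t' + 1, s'', .loop_true ?_ h1 h1', ?_, h3'⟩
      · simp [Test.Holds, (hI _ _ hIk).1, (hI _ _ hIk).2, hkm]
      · rw [Finset.sum_eq_sum_Ico_succ_bot hkm]; omega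
  simpa using key m 0 s (by simp) h0

theorem Halts.loop_const {x y m : ℕ} (I : ℕ → Store → Prop) (C : ℕ)
    (hI : ∀ k s, I k s → s.nat x = k ∧ s.nat y = m)
    (hstep : ∀ k < m, ∀ s, I k s → Halts D c s C (I (k + 1))) (h0 : I 0 s) :
    Halts D (.loop (.natLt x y) c) s (m * (C + 1) + 1) (I m) := by
  simpa using Halts.loop I (fun _ => C) hI hstep h0

end Rules

/-! ### The program -/

/-- Sets the register `x` to `0` and runs `c` as long as `nat[x] < nat[y]`. -/
def forLoop (x y : ℕ) (c : Prog) : Prog := .seq (.op (.const x 0)) (.loop (.natLt x y) c)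

/-- Computes in array `1` the codes of the restrictions of the samples to the current set. -/
def codeProg : Prog :=
  .seq (forLoop 10 1 (block [.store 1 10 3, .add 10 10 4]))
    (forLoop 9 0 (.seq (.op (.load 11 0 9)) (.seq
      (.ite (.natEq 11 4)
        (forLoop 10 1 (block [.load 11 1 10, .input 12 10 9, .add 11 11 11, .add 11 11 12,
          .store 1 10 11, .add 10 10 4]))
        .skip)
      (.op (.add 9 9 4)))))

/-- Sets the counters of all occurring codes to `0`. -/
def clearProg : Prog :=
  forLoop 10 1 (block [.load 11 1 10, .rstore 0 11 3, .rstore 1 11 3, .rstore 2 11 3,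
    .rstore 3 11 3, .add 10 10 4])

/-- Counts, for each code, all samples, those with `+` at `i`, and those with `+` at `u` and
`+` or `-` at `i`. -/
def countProg : Prog :=
  forLoop 10 1 (block [.load 11 1 10, .input 12 10 6, .input 13 10 2, .cast 4 4, .cast 5 12,
    .cast 6 13, .rload 7 0 11, .radd 7 7 4, .rstore 0 11 7, .rload 7 1 11, .radd 7 7 5,
    .rstore 1 11 7, .rmul 8 5 6, .rload 7 2 11, .radd 7 7 8, .rstore 2 11 7, .rsub 8 6 8,
    .rload 7 3 11, .radd 7 7 8, .rstore 3 11 7, .add 10 10 4])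

/-- Sums up the contributions of the samples to the influence. -/
def sumProg : Prog :=
  .seq (forLoop 10 1 (.seq
    (block [.load 11 1 10, .rload 4 0 11, .rload 5 1 11, .rload 6 2 11, .rload 7 3 11,
      .rsub 8 4 5, .rdiv 9 6 5, .rdiv 10 7 8, .rsub 9 9 10, .rdiv 5 5 4, .rdiv 8 8 4,
      .radd 10 5 5, .rmul 10 10 8])
    (.seq (.ite (.realLt 9 3) (.op (.rsub 9 3 9)) .skip)
      (block [.rmul 10 10 9, .radd 2 2 10, .add 10 10 4]))))
    (block [.cast 4 1, .rdiv 2 2 4])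

/-- Computes in real register `2` the influence of `i = nat[6]` given the current set. -/
def inflProg : Prog :=
  .seq clearProg (.seq countProg (.seq (.op (.radd 2 3 3)) sumProg))

/-- Finds a node of maximal influence. -/
def argmaxProg : Prog :=
  .seq (block [.add 7 3 3, .radd 1 3 3]) (forLoop 6 0 (.seq inflProg (.seq (.op (.load 8 0 6)) (.seq
    (.ite (.natEq 8 3) (.ite (.natEq 6 2) .skip
      (.ite (.realLt 1 2) (block [.add 7 6 3, .radd 1 2 3]) .skip)) .skip)
    (.op (.add 6 6 4))))))

/-- The greedy phase. -/
def greedyProg : Prog :=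
  .loop (.natEq 5 4) (.seq codeProg (.seq argmaxProg
    (.ite (.realLt 1 0) (.op (.const 5 0)) (.op (.store 0 7 4)))))

/-- The pruning phase. -/
def pruneProg : Prog :=
  forLoop 6 0 (.seq (.op (.load 8 0 6)) (.seq
    (.ite (.natEq 8 4)
      (.seq (.op (.store 0 6 3)) (.seq codeProg (.seq inflProg
        (.ite (.realLt 2 0) .skip (.op (.store 0 6 4))))))
      .skip)
    (.op (.add 6 6 4))))

/-- The program that implements the algorithm. -/
def learnProg : Prog :=
  .seq (block [.const 4 1, .const 5 1]) (.seq greedyProg pruneProg)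

/-- The registers that hold the input and the constants. -/
structure Env (p n u : ℕ) (τ : ℝ) (s : Store) : Prop where
  nat_zero : s.nat 0 = p
  nat_one : s.nat 1 = n
  nat_two : s.nat 2 = u
  nat_three : s.nat 3 = 0
  nat_four : s.nat 4 = 1
  real_zero : s.real 0 = τ
  real_three : s.real 3 = 0

theorem Env.congr {p n u : ℕ} {τ : ℝ} {s s' : Store} (h : Env p n u τ s)
    (hn : ∀ r < 5, s'.nat r = s.nat r) (h0 : s'.real 0 = s.real 0) (h3 : s'.real 3 = s.real 3) :
    Env p n u τ s' :=
  ⟨(hn 0 (by norm_num)).trans h.1, (hn 1 (by norm_num)).trans h.2, (hn 2 (by norm_num)).trans h.3,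
    (hn 3 (by norm_num)).trans h.4, (hn 4 (by norm_num)).trans h.5, h0.trans h.6, h3.trans h.7⟩

/-- The binary code of the entries of row `t` in those of the first `k` columns that are marked
in `a`. -/
def rowCode (D : ℕ → ℕ → ℕ) (a : ℕ → ℕ) (t : ℕ) : ℕ → ℕ
  | 0 => 0
  | k + 1 => if a k = 1 then rowCode D a t k + rowCode D a t k + D t k else rowCode D a t k

theorem rowCode_inj {D : ℕ → ℕ → ℕ} (hD : ∀ t j, D t j ≤ 1) (a : ℕ → ℕ) (t t' k : ℕ) :
    rowCode D a t k = rowCode D a t' k ↔ ∀ j < k, a j = 1 → D t j = D t' j := by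
  induction k with
  | zero => simp [rowCode]
  | succ k ih =>
    have h1 := hD t k
    have h2 := hD t' k
    simp only [rowCode, Nat.forall_lt_succ_right]
    split_ifs with h
    · rw [← ih]
      simp only [h, true_implies]
      omega
    · simp [ih, h]

/-- The sum of `f` over the rows with code `c`. -/
noncomputable def countOf (cls : ℕ → ℕ) (f : ℕ → ℝ) (m c : ℕ) : ℝ :=
  ∑ t ∈ Finset.range m, if cls t = c then f t else 0

theorem countOf_succ (cls : ℕ → ℕ) (f : ℕ → ℝ) (m c : ℕ) :
    countOf cls f (m + 1) c = countOf cls f m c + if c = cls m then f m else 0 := by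
  simp only [countOf, Finset.sum_range_succ, eq_comm]

/-- The contribution of a row with code `c` to the influence of column `i` on column `u`. -/
noncomputable def rowTerm (D : ℕ → ℕ → ℕ) (cls : ℕ → ℕ) (n u i c : ℕ) : ℝ :=
  (countOf cls (fun t => D t i) n c / countOf cls (fun _ => 1) n c +
      countOf cls (fun t => D t i) n c / countOf cls (fun _ => 1) n c) *
    ((countOf cls (fun _ => 1) n c - countOf cls (fun t => D t i) n c) /
      countOf cls (fun _ => 1) n c) *
    |countOf cls (fun t => D t i * D t u) n c / countOf cls (fun t => D t i) n c -
      countOf cls (fun t => D t u - D t i * D t u) n c /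
        (countOf cls (fun _ => 1) n c - countOf cls (fun t => D t i) n c)|

section Specs

variable {D : ℕ → ℕ → ℕ} {p n u : ℕ} {τ : ℝ} {s : Store}

theorem codeProg_spec (hs : Env p n u τ s) :
    Halts D codeProg s (20 * (p + 1) * (n + 1)) fun s' =>
      (∀ r < 9, s'.nat r = s.nat r) ∧ s'.arr 0 = s.arr 0 ∧ s'.real = s.real ∧
        ∀ t < n, s'.arr 1 t = rowCode D (s.arr 0) t p := by
  have h1 : Halts D (forLoop 10 1 (block [.store 1 10 3, .add 10 10 4])) s
      (1 + (n * (3 + 1) + 1)) fun s' =>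
      (∀ r < 9, s'.nat r = s.nat r) ∧ s'.arr 0 = s.arr 0 ∧ s'.real = s.real ∧
        ∀ t < n, s'.arr 1 t = 0 := by
    refine Halts.seq (R := fun s' => (s'.nat 10 = 0 ∧ s'.nat 1 = n) ∧
      (∀ r < 9, s'.nat r = s.nat r) ∧ s'.arr 0 = s.arr 0 ∧ s'.real = s.real) ?_ fun s1 hs1 => ?_
    · apply Halts.op
      simp +contextual [hs.nat_one]
      intros; omega
    · refine (Halts.loop_const (I := fun k s' => (s'.nat 10 = k ∧ s'.nat 1 = n) ∧
        (∀ r < 9, s'.nat r = s.nat r) ∧ s'.arr 0 = s.arr 0 ∧ s'.real = s.real ∧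
        ∀ t < k, s'.arr 1 t = 0) 3 (fun k s h => h.1) ?_ ?_).mono le_rfl fun s' h => h.2
      · rintro k hk s2 ⟨⟨h10, hn⟩, hr, ha, hre, ht⟩
        apply Halts.block
        have h3 := (hr 3 (by norm_num)).trans hs.nat_three
        have h4 := (hr 4 (by norm_num)).trans hs.nat_four
        refine ⟨by simp [h10, hn, h4], ?_, ?_, ?_, ?_⟩
        · intro r hr'
          simp [hr r hr', show r ≠ 10 by omega]
        · ext j; simp [ha]
        · simp [hre]
        · intro t ht'
          simp only [List.foldl_cons, List.foldl_nil, apply_add_arr, apply_store_arr, h10, h3,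
            true_and]
          split_ifs with h
          · rfl
          · exact ht t (by omega)
      · exact ⟨hs1.1, hs1.2.1, hs1.2.2.1, hs1.2.2.2, by simp⟩
  refine (Halts.seq h1 (N₂ := 1 + (p * ((1 + ((1 + (n * (7 + 1) + 1)) + 1 + 1)) + 1) + 1))
    fun s1 ⟨hr1, ha1, hre1, ht1⟩ => ?_).mono (by ring_nf; omega) fun _ h => h
  refine Halts.seq (R := fun s' => (s'.nat 9 = 0 ∧ s'.nat 0 = p) ∧
      (∀ r < 9, s'.nat r = s.nat r) ∧ s'.arr 0 = s.arr 0 ∧ s'.real = s.real ∧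
        ∀ t < n, s'.arr 1 t = 0) ?_ fun s2 hs2 => ?_
  · apply Halts.op
    refine ⟨by simp [hr1 0, hs.nat_zero], fun r hr => ?_, by simp [ha1], by simp [hre1], ?_⟩
    · simp [hr1 r hr, show r ≠ 9 by omega]
    · simpa using ht1
  refine (Halts.loop_const (I := fun k s' => (s'.nat 9 = k ∧ s'.nat 0 = p) ∧
      (∀ r < 9, s'.nat r = s.nat r) ∧ s'.arr 0 = s.arr 0 ∧ s'.real = s.real ∧
      ∀ t < n, s'.arr 1 t = rowCode D (s.arr 0) t k) _ (fun k s h => h.1) ?_ ?_).mono le_rfl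
      fun s' h => h.2
  swap
  · exact hs2
  rintro k hk s3 ⟨⟨h9, h0⟩, hr, ha, hre, ht⟩
  refine Halts.seq (R := fun s' => (s'.nat 9 = k ∧ s'.nat 11 = s.arr 0 k) ∧
      (∀ r < 9, s'.nat r = s.nat r) ∧ s'.arr 0 = s.arr 0 ∧ s'.real = s.real ∧
      ∀ t < n, s'.arr 1 t = rowCode D (s.arr 0) t k) ?_
      fun s4 ⟨⟨h9, h11⟩, hr, ha, hre, ht⟩ => ?_
  · apply Halts.op
    refine ⟨by simp [h9, ha], fun r hr' => ?_, by simp [ha], by simp [hre], ?_⟩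
    · simp [hr r hr', show r ≠ 11 by omega]
    · simpa using ht
  have h4 := (hr 4 (by norm_num)).trans hs.nat_four
  refine Halts.seq (R := fun s' => (s'.nat 9 = k) ∧
      (∀ r < 9, s'.nat r = s.nat r) ∧ s'.arr 0 = s.arr 0 ∧ s'.real = s.real ∧
      ∀ t < n, s'.arr 1 t = rowCode D (s.arr 0) t (k + 1)) (Halts.ite ?_ ?_)
      fun s5 ⟨h9, hr, ha, hre, ht⟩ => ?_
  · intro hb
    have hak : s.arr 0 k = 1 := by simpa [Test.Holds, h4, h11] using hb
    refine Halts.seq (R := fun s' => (s'.nat 10 = 0 ∧ s'.nat 1 = n) ∧ s'.nat 9 = k ∧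
      (∀ r < 9, s'.nat r = s.nat r) ∧ s'.arr 0 = s.arr 0 ∧ s'.real = s.real ∧
      ∀ t < n, s'.arr 1 t = rowCode D (s.arr 0) t k) ?_ fun s6 hs6 => ?_
    · apply Halts.op
      refine ⟨by simp [hr 1, hs.nat_one], by simp [h9], fun r hr' => ?_, by simp [ha],
        by simp [hre], by simpa using ht⟩
      simp [hr r hr', show r ≠ 10 by omega]
    refine (Halts.loop_const (I := fun m s' => (s'.nat 10 = m ∧ s'.nat 1 = n) ∧ s'.nat 9 = k ∧
      (∀ r < 9, s'.nat r = s.nat r) ∧ s'.arr 0 = s.arr 0 ∧ s'.real = s.real ∧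
      ∀ t < n, s'.arr 1 t = rowCode D (s.arr 0) t (if t < m then k + 1 else k)) 7
      (fun k s h => h.1) ?_ ?_).mono le_rfl fun s' h => ⟨h.2.1, h.2.2.1, h.2.2.2.1, h.2.2.2.2.1,
        fun t ht => by simpa [ht] using h.2.2.2.2.2 t ht⟩
    swap
    · simpa using hs6
    rintro m hm s7 ⟨⟨h10, hn⟩, h9, hr, ha, hre, ht⟩
    apply Halts.block
    have h4 := (hr 4 (by norm_num)).trans hs.nat_four
    refine ⟨by simp [h10, hn, h4], by simp [h9], fun r hr' => ?_, ?_, by simp [hre], ?_⟩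
    · simp [hr r hr', show r ≠ 10 by omega, show r ≠ 11 by omega, show r ≠ 12 by omega]
    · ext j; simp [ha]
    · intro t ht'
      have htm := ht m hm
      simp only [lt_irrefl, if_false] at htm
      simp only [List.foldl_cons, List.foldl_nil, apply_add_arr, apply_store_arr, apply_load_arr,
        apply_input_arr, apply_add_nat, apply_load_nat, apply_input_nat, h10, h9, htm]
      norm_num
      by_cases h : t = m
      · subst h; simp [rowCode, hak]
      · rw [if_neg h, ht t ht']
        have : t ≤ m ↔ t < m := by omega
        simp [this]
  · intro hb
    have hak : s.arr 0 k ≠ 1 := by simpa [Test.Holds, h4, h11] using hb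
    refine Halts.mono (N₁ := 1) (Q := fun s' => s'.nat 9 = k ∧ (∀ r < 9, s'.nat r = s.nat r) ∧
      s'.arr 0 = s.arr 0 ∧ s'.real = s.real ∧ ∀ t < n, s'.arr 1 t = rowCode D (s.arr 0) t (k + 1))
      (Halts.skip ?_) (by omega) fun _ h => h
    exact ⟨h9, hr, ha, hre, fun t h => by simp [rowCode, hak, ht t h]⟩
  · apply Halts.op
    have h4 := (hr 4 (by norm_num)).trans hs.nat_four
    refine ⟨by simp [h9, h4, hr 0, hs.nat_zero], fun r hr' => ?_, by simp [ha], by simp [hre],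
      by simpa using ht⟩
    simp [hr r hr', show r ≠ 9 by omega]

theorem clearProg_spec (hs : Env p n u τ s) :
    Halts D clearProg s (1 + (n * (7 + 1) + 1)) fun s' =>
      (∀ r < 10, s'.nat r = s.nat r) ∧ s'.arr = s.arr ∧ s'.real = s.real ∧
        ∀ a < 4, ∀ t < n, s'.rarr a (s.arr 1 t) = 0 := by
  refine Halts.seq (R := fun s' => (s'.nat 10 = 0 ∧ s'.nat 1 = n) ∧
      (∀ r < 10, s'.nat r = s.nat r) ∧ s'.arr = s.arr ∧ s'.real = s.real) ?_ fun s1 hs1 => ?_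
  · apply Halts.op
    refine ⟨by simp [hs.nat_one], fun r hr => ?_, rfl, rfl⟩
    simp [show r ≠ 10 by omega]
  refine (Halts.loop_const (I := fun k s' => (s'.nat 10 = k ∧ s'.nat 1 = n) ∧
        (∀ r < 10, s'.nat r = s.nat r) ∧ s'.arr = s.arr ∧ s'.real = s.real ∧
        ∀ a < 4, ∀ t < k, s'.rarr a (s.arr 1 t) = 0) 7 (fun k s h => h.1) ?_ ?_).mono le_rfl
        fun s' h => h.2
  swap
  · exact ⟨hs1.1, hs1.2.1, hs1.2.2.1, hs1.2.2.2, by simp⟩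
  rintro k hk s2 ⟨⟨h10, hn⟩, hr, ha, hre, ht⟩
  apply Halts.block
  have h3 := (hr 3 (by norm_num)).trans hs.nat_three
  have h4 := (hr 4 (by norm_num)).trans hs.nat_four
  have hr3 : s2.real 3 = 0 := by rw [hre, hs.real_three]
  refine ⟨by simp [h10, hn, h4], fun r hr' => ?_, by simp [ha], by simp [hre],
    fun a ha' t ht' => ?_⟩
  · simp [hr r hr', show r ≠ 10 by omega, show r ≠ 11 by omega]
  · simp only [List.foldl_cons, List.foldl_nil, apply_add_rarr, apply_rstore_rarr,
      apply_load_rarr, apply_rstore_nat, apply_rstore_real, apply_load_real, apply_load_nat,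
      h10, ha, hr3, if_true]
    by_cases h : s.arr 1 t = s.arr 1 k
    · simp only [h, and_true]; interval_cases a <;> simp
    · simp only [h, and_false, if_false]
      refine ht a ha' t ?_
      rcases Nat.lt_succ_iff_lt_or_eq.1 ht' with h' | h'
      · exact h'
      · exact absurd (by rw [h']) h

theorem countProg_spec (hs : Env p n u τ s) {i : ℕ} (hi : s.nat 6 = i)
    (h0 : ∀ a < 4, ∀ t < n, s.rarr a (s.arr 1 t) = 0) :
    Halts D countProg s (1 + (n * (22 + 1) + 1)) fun s' =>
      (∀ r < 10, s'.nat r = s.nat r) ∧ s'.arr = s.arr ∧ (∀ r < 4, s'.real r = s.real r) ∧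
        ∀ t < n, s'.rarr 0 (s.arr 1 t) = countOf (s.arr 1) (fun _ => 1) n (s.arr 1 t) ∧
          s'.rarr 1 (s.arr 1 t) = countOf (s.arr 1) (fun t => D t i) n (s.arr 1 t) ∧
          s'.rarr 2 (s.arr 1 t) = countOf (s.arr 1) (fun t => D t i * D t u) n (s.arr 1 t) ∧
          s'.rarr 3 (s.arr 1 t) =
            countOf (s.arr 1) (fun t => D t u - D t i * D t u) n (s.arr 1 t) := by
  refine Halts.seq (R := fun s' => (s'.nat 10 = 0 ∧ s'.nat 1 = n) ∧
      (∀ r < 10, s'.nat r = s.nat r) ∧ s'.arr = s.arr ∧ (∀ r < 4, s'.real r = s.real r) ∧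
      s'.rarr = s.rarr) ?_
      fun s1 hs1 => ?_
  · apply Halts.op
    refine ⟨by simp [hs.nat_one], fun r hr => ?_, rfl, fun _ _ => rfl, rfl⟩
    simp [show r ≠ 10 by omega]
  refine (Halts.loop_const (I := fun k s' => (s'.nat 10 = k ∧ s'.nat 1 = n) ∧
        (∀ r < 10, s'.nat r = s.nat r) ∧ s'.arr = s.arr ∧ (∀ r < 4, s'.real r = s.real r) ∧
        ∀ t < n, s'.rarr 0 (s.arr 1 t) = countOf (s.arr 1) (fun _ => 1) k (s.arr 1 t) ∧
          s'.rarr 1 (s.arr 1 t) = countOf (s.arr 1) (fun t => D t i) k (s.arr 1 t) ∧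
          s'.rarr 2 (s.arr 1 t) = countOf (s.arr 1) (fun t => D t i * D t u) k (s.arr 1 t) ∧
          s'.rarr 3 (s.arr 1 t) =
            countOf (s.arr 1) (fun t => D t u - D t i * D t u) k (s.arr 1 t))
        22 (fun k s h => h.1) ?_ ?_).mono le_rfl
        fun s' h => h.2
  swap
  · refine ⟨hs1.1, hs1.2.1, hs1.2.2.1, hs1.2.2.2.1, fun t ht => ?_⟩
    rw [hs1.2.2.2.2]
    simp [countOf, h0 _ _ t ht]
  rintro k hk s2 ⟨⟨h10, hn⟩, hr, ha, hre, ht⟩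
  apply Halts.block
  have h2 := (hr 2 (by norm_num)).trans hs.nat_two
  have h4 := (hr 4 (by norm_num)).trans hs.nat_four
  have h6 := (hr 6 (by norm_num)).trans hi
  refine ⟨by simp [h10, hn, h4], fun r hr' => ?_, by simp [ha], fun r hr' => ?_, ?_⟩
  · simp [hr r hr', show r ≠ 10 by omega, show r ≠ 11 by omega, show r ≠ 12 by omega,
      show r ≠ 13 by omega]
  · simp [hre r hr', show r ≠ 4 by omega, show r ≠ 5 by omega, show r ≠ 6 by omega,
      show r ≠ 7 by omega, show r ≠ 8 by omega]
  · intro t ht'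
    obtain ⟨ht0, ht1, ht2, ht3⟩ := ht t ht'
    simp only [countOf_succ]
    by_cases h : s.arr 1 t = s.arr 1 k
    · rw [h] at ht0 ht1 ht2 ht3
      simp [h10, h2, h4, h6, ha, h, ht0, ht1, ht2, ht3]
    · simp [h10, ha, h, ht0, ht1, ht2, ht3]

theorem sumProg_spec (hs : Env p n u τ s) {i : ℕ} (h2 : s.real 2 = 0)
    (h0 : ∀ t < n, s.rarr 0 (s.arr 1 t) = countOf (s.arr 1) (fun _ => 1) n (s.arr 1 t) ∧
          s.rarr 1 (s.arr 1 t) = countOf (s.arr 1) (fun t => D t i) n (s.arr 1 t) ∧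
          s.rarr 2 (s.arr 1 t) = countOf (s.arr 1) (fun t => D t i * D t u) n (s.arr 1 t) ∧
          s.rarr 3 (s.arr 1 t) =
            countOf (s.arr 1) (fun t => D t u - D t i * D t u) n (s.arr 1 t)) :
    Halts D sumProg s (1 + (n * ((14 + ((1 + 1) + 4)) + 1) + 1) + 3) fun s' =>
      (∀ r < 10, s'.nat r = s.nat r) ∧ s'.arr = s.arr ∧ s'.real 0 = s.real 0 ∧
        s'.real 1 = s.real 1 ∧ s'.real 3 = s.real 3 ∧
        s'.real 2 = (∑ t ∈ Finset.range n, rowTerm D (s.arr 1) n u i (s.arr 1 t)) / n := by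
  refine Halts.seq (R := fun s' => 
      (∀ r < 10, s'.nat r = s.nat r) ∧ s'.arr = s.arr ∧ s'.real 0 = s.real 0 ∧
        s'.real 1 = s.real 1 ∧ s'.real 3 = s.real 3 ∧
        s'.real 2 = ∑ t ∈ Finset.range n, rowTerm D (s.arr 1) n u i (s.arr 1 t)) ?_ ?_
  swap
  · rintro s1 ⟨hr, ha, hr0, hr1, hr3, hr2⟩
    apply Halts.block
    have h1 := (hr 1 (by norm_num)).trans hs.nat_one
    exact ⟨by simpa using hr, by simp [ha], by simp [hr0], by simp [hr1], by simp [hr3],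
      by simp [h1, hr2]⟩
  refine Halts.seq (R := fun s' => (s'.nat 10 = 0 ∧ s'.nat 1 = n) ∧
      (∀ r < 10, s'.nat r = s.nat r) ∧ s'.arr = s.arr ∧ s'.real = s.real ∧
      s'.rarr = s.rarr) ?_
      fun s1 hs1 => ?_
  · apply Halts.op
    refine ⟨by simp [hs.nat_one], fun r hr => ?_, rfl, rfl, rfl⟩
    simp [show r ≠ 10 by omega]
  refine (Halts.loop_const (I := fun k s' => (s'.nat 10 = k ∧ s'.nat 1 = n) ∧
        (∀ r < 10, s'.nat r = s.nat r) ∧ s'.arr = s.arr ∧ s'.real 0 = s.real 0 ∧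
        s'.real 1 = s.real 1 ∧ s'.real 3 = s.real 3 ∧ s'.rarr = s.rarr ∧
        s'.real 2 = ∑ t ∈ Finset.range k, rowTerm D (s.arr 1) n u i (s.arr 1 t))
        (14 + ((1 + 1) + 4)) (fun k s h => h.1) ?_ ?_).mono le_rfl
        fun s' h => ⟨h.2.1, h.2.2.1, h.2.2.2.1, h.2.2.2.2.1, h.2.2.2.2.2.1, h.2.2.2.2.2.2.2⟩
  swap
  · exact ⟨hs1.1, hs1.2.1, hs1.2.2.1, by rw [hs1.2.2.2.1], by rw [hs1.2.2.2.1],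
      by rw [hs1.2.2.2.1], hs1.2.2.2.2, by rw [hs1.2.2.2.1]; simp [h2]⟩
  rintro k hk s2 ⟨⟨h10, hn⟩, hr, ha, hr0, hr1, hr3, hra, hr2⟩
  have h3 := hr3.trans hs.real_three
  have h4 := (hr 4 (by norm_num)).trans hs.nat_four
  obtain ⟨hc0, hc1, hc2, hc3⟩ := h0 k hk
  set c := s.arr 1 k with hc
  refine Halts.seq (R := fun s' => (s'.nat 10 = k ∧ s'.nat 1 = n) ∧
        (∀ r < 10, s'.nat r = s.nat r) ∧ s'.arr = s.arr ∧ s'.real 0 = s.real 0 ∧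
        s'.real 1 = s.real 1 ∧ s'.real 3 = s.real 3 ∧ s'.rarr = s.rarr ∧
        s'.real 2 = (∑ t ∈ Finset.range k, rowTerm D (s.arr 1) n u i (s.arr 1 t)) ∧
        s'.real 10 = (countOf (s.arr 1) (fun t => D t i) n c / countOf (s.arr 1) (fun _ => 1) n c +
            countOf (s.arr 1) (fun t => D t i) n c / countOf (s.arr 1) (fun _ => 1) n c) *
          ((countOf (s.arr 1) (fun _ => 1) n c - countOf (s.arr 1) (fun t => D t i) n c) /
            countOf (s.arr 1) (fun _ => 1) n c) ∧
        s'.real 9 = countOf (s.arr 1) (fun t => D t i * D t u) n c /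
            countOf (s.arr 1) (fun t => D t i) n c -
          countOf (s.arr 1) (fun t => D t u - D t i * D t u) n c /
            (countOf (s.arr 1) (fun _ => 1) n c - countOf (s.arr 1) (fun t => D t i) n c)) ?_ ?_
  · apply Halts.block
    refine ⟨by simp [h10, hn], fun r hr' => ?_, by simp [ha], by simp [hr0], by simp [hr1],
      by simp [hr3], by simp [hra], by simp [hr2], ?_, ?_⟩
    · simp [hr r hr', show r ≠ 11 by omega]
    · simp [h10, ha, hra, ← hc, hc0, hc1]
    · simp [h10, ha, hra, ← hc, hc0, hc1, hc2, hc3]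
  rintro s3 ⟨⟨h10, hn⟩, hr, ha, hr0, hr1, hr3, hra, hr2, hr10, hr9⟩
  have h3 := hr3.trans hs.real_three
  refine Halts.seq (R := fun s' => (s'.nat 10 = k ∧ s'.nat 1 = n) ∧
        (∀ r < 10, s'.nat r = s.nat r) ∧ s'.arr = s.arr ∧ s'.real 0 = s.real 0 ∧
        s'.real 1 = s.real 1 ∧ s'.real 3 = s.real 3 ∧ s'.rarr = s.rarr ∧
        s'.real 2 = (∑ t ∈ Finset.range k, rowTerm D (s.arr 1) n u i (s.arr 1 t)) ∧
        s'.real 10 = s3.real 10 ∧ s'.real 9 = |s3.real 9|) ?_ ?_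
  · refine Halts.ite (fun hb => ?_) (fun hb => ?_)
    · simp only [Test.Holds, h3] at hb
      apply Halts.op
      refine ⟨by simp [h10, hn], by simpa using hr, by simp [ha], by simp [hr0], by simp [hr1],
        by simp [hr3], by simp [hra], by simp [hr2], by simp, ?_⟩
      simp [h3, abs_of_neg hb]
    · simp only [Test.Holds, h3, not_lt] at hb
      apply Halts.skip
      exact ⟨⟨h10, hn⟩, hr, ha, hr0, hr1, hr3, hra, hr2, rfl, (abs_of_nonneg hb).symm⟩
  · rintro s4 ⟨⟨h10, hn⟩, hr, ha, hr0, hr1, hr3, hra, hr2, hr10', hr9'⟩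
    apply Halts.block
    have h4 := (hr 4 (by norm_num)).trans hs.nat_four
    refine ⟨by simp [h10, hn, h4], fun r hr' => ?_, by simp [ha], by simp [hr0], by simp [hr1],
      by simp [hr3], by simp [hra], ?_⟩
    · simp [hr r hr', show r ≠ 10 by omega]
    · rw [Finset.sum_range_succ]
      simp only [List.foldl_cons, List.foldl_nil, apply_add_real, apply_radd_real,
        apply_rmul_real, hr2, hr10', hr9', hr10, hr9, rowTerm, ← hc]
      simp

theorem inflProg_spec (hs : Env p n u τ s) {i : ℕ} (hi : s.nat 6 = i) :
    Halts D inflProg s (60 * (n + 1)) fun s' =>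
      (∀ r < 10, s'.nat r = s.nat r) ∧ s'.arr = s.arr ∧ s'.real 0 = s.real 0 ∧
        s'.real 1 = s.real 1 ∧ s'.real 3 = s.real 3 ∧
        s'.real 2 = (∑ t ∈ Finset.range n, rowTerm D (s.arr 1) n u i (s.arr 1 t)) / n := by
  refine (Halts.seq (clearProg_spec hs) fun s1 ⟨hr1, ha1, hre1, h01⟩ => Halts.seq
    (countProg_spec (i := i) (hs.congr (fun r hr => hr1 r (by omega)) (by rw [hre1]) (by rw [hre1]))
      (by rw [hr1 6 (by norm_num), hi]) (by rw [ha1]; exact h01))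
    fun s2 ⟨hr2, ha2, hre2, h02⟩ => Halts.seq
      (R := fun s' => (∀ r < 10, s'.nat r = s.nat r) ∧ s'.arr = s.arr ∧ s'.real 0 = s.real 0 ∧
        s'.real 1 = s.real 1 ∧ s'.real 3 = s.real 3 ∧ s'.real 2 = 0 ∧ s'.rarr = s2.rarr)
      (Halts.op ?op) fun s3 ⟨hr3, ha3, hr30, hr31, hr33, hr32, hra3⟩ => (sumProg_spec (i := i)
        (hs.congr (fun r hr => hr3 r (by omega)) hr30 hr33) hr32 ?cnt).mono le_rfl ?post).mono ?cost
        fun _ h => h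
  case op =>
    refine ⟨fun r hr => ?_, by simp [ha2, ha1], ?_, ?_, ?_, ?_, rfl⟩
    · simp [hr2 r hr, hr1 r hr]
    · simp [hre2, hre1]
    · simp [hre2, hre1]
    · simp [hre2, hre1]
    · simp [hre2, hre1, hs.real_three]
  case cnt =>
    rw [hra3, ha3, ← ha1]
    exact h02
  case post =>
    rintro s4 ⟨hr4, ha4, hr40, hr41, hr43, hr42⟩
    refine ⟨fun r hr => (hr4 r hr).trans (hr3 r hr), ha4.trans ha3, hr40.trans hr30,
      hr41.trans hr31, hr43.trans hr33, ?_⟩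
    rw [hr42, ha3]
  case cost => ring_nf; omega

end Specs

/-- The first `p` cells of `a` hold the indicator function of `S`. -/
def Marks {p : ℕ} (a : ℕ → ℕ) (S : Finset (Fin p)) : Prop :=
  ∀ j : Fin p, a j = if j ∈ S then 1 else 0

section Link

variable {p n : ℕ} {X : Samples p n}

theorem inputMatrix_fin (X : Samples p n) (t : Fin n) (i : Fin p) :
    inputMatrix X t i = if X t i then 1 else 0 := by
  simp [inputMatrix]

theorem inputMatrix_le_one (X : Samples p n) (t i : ℕ) : inputMatrix X t i ≤ 1 := by
  unfold inputMatrix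
  split_ifs <;> simp

theorem rowCode_eq_iff_agree {a : ℕ → ℕ} {S : Finset (Fin p)} (ha : Marks a S) (t t' : Fin n) :
    rowCode (inputMatrix X) a t p = rowCode (inputMatrix X) a t' p ↔
      X t ∈ agreeEvent S (X t') := by
  rw [rowCode_inj (inputMatrix_le_one X)]
  constructor
  · intro h j hj
    have := h j j.2 (by simp [ha j, hj])
    rw [inputMatrix_fin, inputMatrix_fin] at this
    revert this
    cases X t j <;> cases X t' j <;> simp
  · intro h j hj haj
    lift j to Fin p using hj
    rw [ha j] at haj
    rw [inputMatrix_fin, inputMatrix_fin, h j (by by_contra hc; simp [hc] at haj)]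

theorem countOf_eq_empMean {a cls : ℕ → ℕ} {S : Finset (Fin p)} (ha : Marks a S)
    (hcls : ∀ t < n, cls t = rowCode (inputMatrix X) a t p) {f : ℕ → ℝ} {g : Config p → ℝ}
    (hfg : ∀ t : Fin n, f t = g (X t)) (t : Fin n) :
    countOf cls f n (cls t) = n * empMean X ((agreeEvent S (X t)).indicator g) := by
  have hn : (n : ℝ) ≠ 0 := by exact_mod_cast (Fin.pos t).ne'
  unfold countOf empMean
  rw [← mul_assoc, mul_one_div_cancel hn, one_mul, Finset.sum_range]
  refine Finset.sum_congr rfl fun t' _ => ?_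
  classical
  rw [Set.indicator_apply, hcls _ t'.2, hcls _ t.2, hfg]
  simp only [rowCode_eq_iff_agree ha]

theorem empMean_sub (X : Samples p n) (f g : Config p → ℝ) :
    empMean X f - empMean X g = empMean X (f - g) := by
  simp [empMean, mul_sub]

theorem sum_rowTerm {a cls : ℕ → ℕ} {S : Finset (Fin p)} (ha : Marks a S)
    (hcls : ∀ t < n, cls t = rowCode (inputMatrix X) a t p) (u i : Fin p) :
    (∑ t ∈ Finset.range n, rowTerm (inputMatrix X) cls n u i (cls t)) / n =
      empMean X fun x => empWeight X i S x * |empNu X u i S x| := by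
  rw [empMean, div_eq_inv_mul, one_div, Finset.sum_range]
  congr 1
  refine Finset.sum_congr rfl fun t _ => ?_
  have hn : (n : ℝ) ≠ 0 := by exact_mod_cast (Fin.pos t).ne'
  have hX : ∀ (t : Fin n) (j : Fin p),
      ((inputMatrix X t j : ℕ) : ℝ) = (spinEvent j true).indicator 1 (X t) := by
    intro t j
    rw [inputMatrix_fin]
    cases h : X t j <;> simp [spinEvent, h]
  have c1 : countOf cls (fun _ => 1) n (cls t) = n * empProb X (agreeEvent S (X t)) :=
    countOf_eq_empMean ha hcls (g := 1) (fun t => by simp) t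
  have c2 : countOf cls (fun t => (inputMatrix X t i : ℝ)) n (cls t) =
      n * empProb X (spinEvent i true ∩ agreeEvent S (X t)) := by
    rw [countOf_eq_empMean ha hcls (g := (spinEvent i true).indicator 1) (fun t => hX t i) t,
      empProb, Set.indicator_indicator, Set.inter_comm]
  have c3 : countOf cls (fun t => (inputMatrix X t i : ℝ) * inputMatrix X t u) n (cls t) =
      n * empProb X (spinEvent u true ∩ (spinEvent i true ∩ agreeEvent S (X t))) := by
    rw [countOf_eq_empMean ha hcls (g := (spinEvent u true ∩ spinEvent i true).indicator 1)
      (fun t => ?_) t, empProb, Set.indicator_indicator, Set.inter_comm, Set.inter_assoc]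
    rw [hX, hX, Set.inter_comm, Set.inter_indicator_one]
    rfl
  have c4 : countOf cls (fun t => (inputMatrix X t u : ℝ) -
      (inputMatrix X t i : ℝ) * inputMatrix X t u) n (cls t) =
      n * empProb X (spinEvent u true ∩ (spinEvent i false ∩ agreeEvent S (X t))) := by
    rw [countOf_eq_empMean ha hcls (g := (spinEvent u true ∩ spinEvent i false).indicator 1)
      (fun t => ?_) t, empProb, Set.indicator_indicator, Set.inter_comm, Set.inter_assoc]
    rw [hX, hX]
    cases h : X t i <;> cases h' : X t u <;> simp [spinEvent, h, h']
  have c5 : n * empProb X (agreeEvent S (X t)) -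
      n * empProb X (spinEvent i true ∩ agreeEvent S (X t)) =
      n * empProb X (spinEvent i false ∩ agreeEvent S (X t)) := by
    rw [← mul_sub, empProb, empProb, empProb, empMean_sub]
    congr 2
    ext x
    by_cases hx : x ∈ agreeEvent S (X t) <;> cases h : x i <;> simp [spinEvent, hx, h]
  rw [rowTerm, c1, c2, c3, c4, c5]
  simp only [mul_div_mul_left _ _ hn, empWeight, empNu, empCond]
  ring

end Link

section Specs

variable {p n : ℕ} {X : Samples p n} {u : Fin p} {τ : ℝ} {s : Store} {S : Finset (Fin p)}

theorem argmaxProg_spec (hs : Env p n u τ s) (hS : Marks (s.arr 0) S)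
    (hcls : ∀ t < n, s.arr 1 t = rowCode (inputMatrix X) (s.arr 0) t p) :
    Halts (inputMatrix X) argmaxProg s (80 * (p + 1) * (n + 1)) fun s' =>
      (∀ r < 6, s'.nat r = s.nat r) ∧ s'.arr = s.arr ∧ s'.real 0 = s.real 0 ∧
        s'.real 3 = s.real 3 ∧ (∀ j, empInfluence X u j S ≤ s'.real 1) ∧
        (s'.real 1 = 0 ∨ ∃ j : Fin p, s'.nat 7 = j ∧ empInfluence X u j S = s'.real 1) := by
  refine (Halts.seq (N₁ := 2 + 1) (R := fun s' =>
      (∀ r < 6, s'.nat r = s.nat r) ∧ s'.arr = s.arr ∧ s'.real 0 = s.real 0 ∧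
        s'.real 3 = s.real 3 ∧ s'.real 1 = 0) (Halts.block ?_)
      (N₂ := 1 + (p * ((60 * (n + 1) + (1 + (3 + 1 + 1 + 1 + 1))) + 1) + 1))
      fun s1 ⟨hr, ha, hr0, hr3, hr1⟩ => ?_).mono ?_ fun _ h => h
  · refine ⟨fun r hr => ?_, by simp, by simp, by simp, by simp [hs.real_three]⟩
    simp [show r ≠ 7 by omega]
  swap
  · ring_nf; nlinarith
  refine Halts.seq (R := fun s' => (s'.nat 6 = 0 ∧ s'.nat 0 = p) ∧
      (∀ r < 6, s'.nat r = s.nat r) ∧ s'.arr = s.arr ∧ s'.real 0 = s.real 0 ∧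
        s'.real 3 = s.real 3 ∧ s'.real 1 = 0) (Halts.op ?_)
      fun s2 ⟨h60, hr, ha, hr0, hr3, hr1⟩ => ?_
  · refine ⟨by simp [hr 0, hs.nat_zero], fun r hr' => ?_, by simp [ha], by simp [hr0],
      by simp [hr3], by simp [hr1]⟩
    simp [hr r hr', show r ≠ 6 by omega]
  refine (Halts.loop_const (I := fun k s' => (s'.nat 6 = k ∧ s'.nat 0 = p) ∧
      (∀ r < 6, s'.nat r = s.nat r) ∧ s'.arr = s.arr ∧ s'.real 0 = s.real 0 ∧
        s'.real 3 = s.real 3 ∧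
      (∀ j : Fin p, (j : ℕ) < k → empInfluence X u j S ≤ s'.real 1) ∧ 0 ≤ s'.real 1 ∧
        (s'.real 1 = 0 ∨ ∃ j : Fin p, s'.nat 7 = j ∧ empInfluence X u j S = s'.real 1))
    (60 * (n + 1) + (1 + (3 + 1 + 1 + 1 + 1)))
    (fun k s h => h.1) ?_ ?_).mono le_rfl fun s' ⟨_, h1, h2, h3, h4, h5, _, h6⟩ =>
      ⟨h1, h2, h3, h4, fun j => h5 j j.2, h6⟩
  swap
  · exact ⟨h60, hr, ha, hr0, hr3, by simp, hr1.ge, Or.inl hr1⟩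
  rintro k hk s3 ⟨⟨h6, h0⟩, hr, ha, hr0, hr3, hle, hnn, hmax⟩
  lift k to Fin p using hk
  refine Halts.seq (R := fun s' => ((s'.nat 6 = k ∧ s'.nat 0 = p) ∧
      (∀ r < 6, s'.nat r = s.nat r) ∧ s'.arr = s.arr ∧ s'.real 0 = s.real 0 ∧
        s'.real 3 = s.real 3 ∧
      (∀ j : Fin p, (j : ℕ) < k → empInfluence X u j S ≤ s'.real 1) ∧ 0 ≤ s'.real 1 ∧
        (s'.real 1 = 0 ∨ ∃ j : Fin p, s'.nat 7 = j ∧ empInfluence X u j S = s'.real 1)) ∧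
        s'.real 2 = empMean X fun x => empWeight X k S x * |empNu X u k S x|) ?_
      fun s4 hs4 => ?_
  · refine (inflProg_spec (hs.congr (fun r h => hr r (by omega)) hr0 hr3) h6).mono le_rfl ?_
    rintro s4 ⟨hr', ha', hr0', hr1', hr3', hr2'⟩
    refine ⟨⟨by simp [hr' 6, hr' 0, h6, h0], fun r h => (hr' r (by omega)).trans (hr r h),
      ha'.trans ha, hr0'.trans hr0, hr3'.trans hr3, by rwa [hr1'], by rwa [hr1'], ?_⟩, ?_⟩
    · rwa [hr1', hr' 7 (by norm_num)]
    · rw [hr2', sum_rowTerm hS (by rw [ha]; exact hcls)]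
  refine Halts.seq (R := fun s' => (((s'.nat 6 = k ∧ s'.nat 0 = p) ∧
      (∀ r < 6, s'.nat r = s.nat r) ∧ s'.arr = s.arr ∧ s'.real 0 = s.real 0 ∧
        s'.real 3 = s.real 3 ∧
      (∀ j : Fin p, (j : ℕ) < k → empInfluence X u j S ≤ s'.real 1) ∧ 0 ≤ s'.real 1 ∧
        (s'.real 1 = 0 ∨ ∃ j : Fin p, s'.nat 7 = j ∧ empInfluence X u j S = s'.real 1)) ∧
        s'.real 2 = empMean X fun x => empWeight X k S x * |empNu X u k S x|) ∧
        s'.nat 8 = if k ∈ S then 1 else 0) (Halts.op ?_)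
      fun s5 ⟨⟨⟨⟨h6, h0⟩, hr, ha, hr0, hr3, hle, hnn, hmax⟩, hr2⟩, h8⟩ => ?_
  · obtain ⟨⟨⟨h6, h0⟩, hr, ha, hr0, hr3, hle, hnn, hmax⟩, hr2⟩ := hs4
    refine ⟨⟨⟨by simp [h6, h0], fun r h => ?_, by simp [ha], by simp [hr0], by simp [hr3],
      by simpa using hle, by simpa using hnn, by simpa using hmax⟩, by simpa using hr2⟩,
      by simp [h6, ha, hS k]⟩
    simp [hr r h, show r ≠ 8 by omega]
  have h3 := (hr 3 (by norm_num)).trans hs.nat_three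
  have h2 := (hr 2 (by norm_num)).trans hs.nat_two
  refine Halts.seq (N₁ := 3 + 1 + 1 + 1) (R := fun s' => ((s'.nat 6 = k ∧ s'.nat 0 = p) ∧
      (∀ r < 6, s'.nat r = s.nat r) ∧ s'.arr = s.arr ∧ s'.real 0 = s.real 0 ∧
        s'.real 3 = s.real 3 ∧
      (∀ j : Fin p, (j : ℕ) < k + 1 → empInfluence X u j S ≤ s'.real 1) ∧ 0 ≤ s'.real 1 ∧
        (s'.real 1 = 0 ∨ ∃ j : Fin p, s'.nat 7 = j ∧ empInfluence X u j S = s'.real 1))) ?_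
      fun s6 ⟨⟨h6, h0⟩, hr, ha, hr0, hr3, hle, hnn, hmax⟩ => Halts.op ?_
  swap
  · have h4 := (hr 4 (by norm_num)).trans hs.nat_four
    refine ⟨by simp [h6, h0, h4], fun r h => ?_, by simp [ha], by simp [hr0], by simp [hr3],
      by simpa using hle, by simpa using hnn, by simpa using hmax⟩
    simp [hr r h, show r ≠ 6 by omega]
  have hsucc : ∀ b : ℝ, (∀ j : Fin p, (j : ℕ) < k → empInfluence X u j S ≤ b) →
      empInfluence X u k S ≤ b → ∀ j : Fin p, (j : ℕ) < k + 1 → empInfluence X u j S ≤ b := by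
    intro b h h' j hj
    rcases Nat.lt_succ_iff_lt_or_eq.1 hj with hj | hj
    · exact h j hj
    · rwa [Fin.ext hj]
  have hskip : empInfluence X u k S ≤ s5.real 1 → Halts (inputMatrix X) .skip s5 1 fun s' =>
      ((s'.nat 6 = k ∧ s'.nat 0 = p) ∧
      (∀ r < 6, s'.nat r = s.nat r) ∧ s'.arr = s.arr ∧ s'.real 0 = s.real 0 ∧
        s'.real 3 = s.real 3 ∧
      (∀ j : Fin p, (j : ℕ) < k + 1 → empInfluence X u j S ≤ s'.real 1) ∧ 0 ≤ s'.real 1 ∧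
        (s'.real 1 = 0 ∨ ∃ j : Fin p, s'.nat 7 = j ∧ empInfluence X u j S = s'.real 1)) :=
    fun h => Halts.skip ⟨⟨h6, h0⟩, hr, ha, hr0, hr3, hsucc _ hle h, hnn, hmax⟩
  refine Halts.ite (fun hb => ?_) fun hb => (hskip ?_).mono (by norm_num) fun _ h => h
  swap
  · have : k ∈ S := by
      by_contra hk
      exact hb (by simp [Test.Holds, h8, hk, h3])
    simpa [empInfluence, this] using hnn
  have hkS : k ∉ S := by
    intro hk
    simp [Test.Holds, h8, hk, h3] at hb
  refine Halts.ite (fun hb => (hskip ?_).mono (by norm_num) fun _ h => h) fun hb => ?_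
  · have : k = u := Fin.ext (by simpa [Test.Holds, h6, h2] using hb)
    simpa [empInfluence, this] using hnn
  have hku : k ≠ u := by
    rintro rfl
    simp [Test.Holds, h6, h2] at hb
  have hinf : s5.real 2 = empInfluence X u k S := by
    rw [hr2, empInfluence, if_neg (by simp [hkS, hku])]
  refine Halts.ite (fun hb => ?_) fun hb => (hskip ?_).mono (by norm_num) fun _ h => h
  swap
  · simpa [Test.Holds, hinf] using hb
  have hlt : s5.real 1 < empInfluence X u k S := by simpa [Test.Holds, hinf] using hb
  apply Halts.block
  refine ⟨by simp [h6, h0], fun r h => ?_, by simp [ha], by simp [hr0], by simp [hr3], ?_, ?_,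
    Or.inr ⟨k, by simp [h6, h3], by simp [hinf, hr3, hs.real_three]⟩⟩
  · simp [hr r h, show r ≠ 7 by omega]
  · simpa [hinf, hr3, hs.real_three] using hsucc _ (fun j hj => (hle j hj).trans hlt.le) le_rfl
  · simpa [hinf, hr3, hs.real_three] using hnn.trans hlt.le

theorem notMem_of_le_empInfluence {i : Fin p} (hτ : 0 < τ) (h : τ ≤ empInfluence X u i S) :
    i ∉ insert u S := by
  intro hi
  rw [empInfluence, if_pos hi] at h
  exact absurd h (not_le.2 hτ)

theorem GreedyReach.self_notMem (hτ : 0 < τ) (h : GreedyReach X τ u S) : u ∉ S := by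
  induction h with
  | empty => simp
  | add S i _ _ h ih =>
    have := notMem_of_le_empInfluence hτ h
    simp only [Finset.mem_insert, not_or] at this ⊢
    exact ⟨fun h => this.1 h.symm, ih⟩

theorem greedyProg_spec (hτ : 0 < τ) (hr : GreedyReach X τ u S) (hs : Env p n u τ s)
    (h5 : s.nat 5 = 1) (hS : Marks (s.arr 0) S) :
    ∃ t s' S', Run (inputMatrix X) greedyProg s t s' ∧ PseudoNbhd X τ u S' ∧
      t + S.card * (104 * (p + 1) * (n + 1)) ≤ (S'.card + 1) * (104 * (p + 1) * (n + 1)) + 1 ∧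
      Env p n u τ s' ∧ Marks (s'.arr 0) S' := by
  induction hm : p - S.card using Nat.strong_induction_on generalizing S s with
  | _ m ih => ?_
  have hbody : Halts (inputMatrix X) (.seq codeProg argmaxProg) s
      (20 * (p + 1) * (n + 1) + 80 * (p + 1) * (n + 1)) fun s' =>
      (∀ r < 6, s'.nat r = s.nat r) ∧ s'.arr 0 = s.arr 0 ∧ s'.real 0 = s.real 0 ∧
        s'.real 3 = s.real 3 ∧ (∀ j, empInfluence X u j S ≤ s'.real 1) ∧
        (s'.real 1 = 0 ∨ ∃ j : Fin p, s'.nat 7 = j ∧ empInfluence X u j S = s'.real 1) := by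
    refine Halts.seq (codeProg_spec hs) fun s1 ⟨hr1, ha1, hre1, hc1⟩ =>
      (argmaxProg_spec (S := S) (X := X)
      (hs.congr (fun r h => hr1 r (by omega)) (by rw [hre1]) (by rw [hre1])) (by rwa [ha1])
      (by rwa [ha1])).mono le_rfl ?_
    rintro s2 ⟨hr2, ha2, hr20, hr23, hj, hmax⟩
    exact ⟨fun r h => (hr2 r h).trans (hr1 r (by omega)), by rw [ha2, ha1], by rw [hr20, hre1],
      by rw [hr23, hre1], hj, hmax⟩
  obtain ⟨t1, s1, hrun, ht1, hr1, ha1, hr10, hr13, hle, hmax⟩ := hbody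
  cases hrun with
  | @seq _ _ _ sa _ ta tb hra hrb => ?_
  have hpos : 1 ≤ (p + 1) * (n + 1) := Nat.one_le_iff_ne_zero.2 (by positivity)
  by_cases hlt : s1.real 1 < s1.real 0
  · refine ⟨_, _, S, .loop_true (by simp [Test.Holds, h5, hs.nat_four])
      (.seq hra (.seq hrb (.ite_true hlt (.op _ _))))
      (.loop_false (by simp [Test.Holds, hr1 4, hs.nat_four])), ⟨hr, fun i => ?_⟩, ?_, ?_, ?_⟩
    · refine (hle i).trans_lt ?_
      rwa [hr10, hs.real_zero] at hlt
    · nlinarith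
    · exact hs.congr (fun r h => by simp [hr1 r (by omega), show r ≠ 5 by omega]) hr10 hr13
    · simpa [ha1] using hS
  · have hge : τ ≤ s1.real 1 := by rw [← hs.real_zero, ← hr10]; exact not_lt.1 hlt
    obtain ⟨j, hj7, hj⟩ := hmax.resolve_left (by linarith)
    have hmem := notMem_of_le_empInfluence hτ (hge.trans hj.ge)
    have hjS : j ∉ S := fun h => hmem (Finset.mem_insert_of_mem h)
    have hcard : (insert j S).card = S.card + 1 := Finset.card_insert_of_notMem hjS
    have hcp : (insert j S).card ≤ p := by simpa using Finset.card_le_univ (insert j S)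
    obtain ⟨t, s', S', hrun, hps, ht, hs', hS'⟩ := ih (p - (insert j S).card) (by omega)
      (s := Op.apply (inputMatrix X) s1 (.store 0 7 4)) (S := insert j S)
      (.add S j hr (fun i => (hle i).trans hj.ge) (hge.trans hj.ge))
      (hs.congr (fun r h => by simp [hr1 r (by omega)]) hr10 hr13)
      (by simp [hr1 5, h5]) (fun i => by
        simp only [apply_store_arr, hj7, hr1 4 (by norm_num), hs.nat_four, ha1, hS i,
          Finset.mem_insert, true_and, Fin.val_inj]
        by_cases h : i = j <;> simp [h]) rfl
    refine ⟨_, s', S', .loop_true (by simp [Test.Holds, h5, hs.nat_four])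
      (.seq hra (.seq hrb (.ite_false hlt (.op _ _)))) hrun, hps, ?_, hs', hS'⟩
    rw [hcard] at ht
    nlinarith

/-- The current set after the pruning loop has treated the nodes below `k`. -/
noncomputable def prunedBelow (X : Samples p n) (τ : ℝ) (u : Fin p) (S : Finset (Fin p)) (k : ℕ) :
    Finset (Fin p) :=
  (((List.finRange p).take k).filter (· ∈ S)).foldl (pruneStep X τ u) S

theorem prunedBelow_succ (k : Fin p) :
    prunedBelow X τ u S (k + 1) =
      if k ∈ S then pruneStep X τ u (prunedBelow X τ u S k) k else prunedBelow X τ u S k := by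
  have : (List.finRange p).take (k + 1) = (List.finRange p).take k ++ [k] := by
    rw [List.take_add_one]
    simp
  unfold prunedBelow
  rw [this, List.filter_append, List.foldl_append]
  by_cases hk : k ∈ S <;> simp [hk]

theorem mem_pruneStep {T : Finset (Fin p)} {i j : Fin p} (h : j ≠ i) :
    j ∈ pruneStep X τ u T i ↔ j ∈ T := by
  unfold pruneStep
  split_ifs <;> simp [h]

theorem pruneProg_spec (hu : u ∉ S) (hs : Env p n u τ s) (hS : Marks (s.arr 0) S) :
    Halts (inputMatrix X) pruneProg s (7 * (p + 1) + S.card * (84 * (p + 1) * (n + 1))) fun s' =>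
      Marks (s'.arr 0) (prunedBelow X τ u S p) := by
  set K := 84 * (p + 1) * (n + 1) with hK
  refine (Halts.seq (R := fun s' => (s'.nat 6 = 0 ∧ s'.nat 0 = p) ∧ Env p n u τ s' ∧
    s'.arr 0 = s.arr 0) (Halts.op ?_) fun s1 ⟨h6, hs1, ha1⟩ =>
    (Halts.loop (m := p) (I := fun k s' => (s'.nat 6 = k ∧ s'.nat 0 = p) ∧ Env p n u τ s' ∧
      Marks (s'.arr 0) (prunedBelow X τ u S k) ∧
      ∀ j : Fin p, k ≤ (j : ℕ) → (j ∈ prunedBelow X τ u S k ↔ j ∈ S))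
      (fun k => 1 + ((if s.arr 0 k = 1 then K else 0) + 1 + 1 + 1)) (fun k s h => h.1) ?_ ?_).mono
      le_rfl fun s' h => h.2.2.1).mono ?_ fun _ h => h
  · exact ⟨by simp [hs.nat_zero], hs.congr (fun r h => by simp [show r ≠ 6 by omega]) rfl rfl, rfl⟩
  · rintro k hk s2 ⟨⟨h6, h0⟩, hs2, hm2, hj2⟩
    lift k to Fin p using hk
    have hkk := hj2 k le_rfl
    set T := prunedBelow X τ u S k with hT
    refine Halts.seq (R := fun s' => s'.nat 6 = k ∧ Env p n u τ s' ∧ Marks (s'.arr 0) T ∧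
      s'.nat 8 = if k ∈ S then 1 else 0) (Halts.op ?_) fun s3 ⟨h6, hs3, hm3, h8⟩ => ?_
    · refine ⟨by simp [h6], hs2.congr (fun r h => by simp [show r ≠ 8 by omega]) rfl rfl,
        by simpa using hm2, ?_⟩
      simp [h6, hm2 k, hkk]
    refine Halts.seq (R := fun s' => s'.nat 6 = k ∧ Env p n u τ s' ∧
      Marks (s'.arr 0) (prunedBelow X τ u S (k + 1))) (Halts.ite (fun hb => ?_) fun hb => ?_)
      fun s4 ⟨h6, hs4, hm4⟩ => Halts.op ?_
    · have hkS : k ∈ S := by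
        by_contra hk
        simp [Test.Holds, h8, hk, hs3.nat_four] at hb
      have hku : k ≠ u := by rintro rfl; exact hu hkS
      rw [if_pos (by simp [hS k, hkS]), prunedBelow_succ, if_pos hkS, ← hT]
      refine (Halts.seq (R := fun s' => s'.nat 6 = k ∧ Env p n u τ s' ∧
        Marks (s'.arr 0) (T.erase k)) (Halts.op ?_) fun s5 ⟨h6, hs5, hm5⟩ =>
        Halts.seq (R := fun s' => s'.nat 6 = k ∧ Env p n u τ s' ∧ Marks (s'.arr 0) (T.erase k) ∧
          ∀ t < n, s'.arr 1 t = rowCode (inputMatrix X) (s'.arr 0) t p)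
          ((codeProg_spec hs5).mono le_rfl ?_) fun s6 ⟨h6, hs6, hm6, hc6⟩ =>
        Halts.seq (R := fun s' => s'.nat 6 = k ∧ Env p n u τ s' ∧ Marks (s'.arr 0) (T.erase k) ∧
          s'.real 2 = empInfluence X u k (T.erase k)) ((inflProg_spec hs6 h6).mono le_rfl ?_)
          fun s7 ⟨h6, hs7, hm7, hr7⟩ => Halts.ite (N := 1) (fun hb => ?_) fun hb => ?_).mono
          (N₂ := K + 1) ?_ fun _ h => h
      · refine ⟨by simp [h6], hs3.congr (fun r h => by simp) rfl rfl, fun j => ?_⟩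
        simp only [apply_store_arr, h6, hs3.nat_three, hm3 j, true_and, Fin.val_inj,
          Finset.mem_erase]
        by_cases h : j = k <;> simp [h]
      · rintro s6 ⟨hr, ha, hre, hc⟩
        exact ⟨by rw [hr 6 (by norm_num), h6], hs5.congr (fun r h => hr r (by omega))
          (by rw [hre]) (by rw [hre]), by rwa [ha], by rwa [ha]⟩
      · rintro s7 ⟨hr, ha, hr0, hr1, hr3, hr2⟩
        refine ⟨by rw [hr 6 (by norm_num), h6], hs6.congr (fun r h => hr r (by omega)) hr0 hr3,
          by rwa [ha], ?_⟩
        rw [hr2, sum_rowTerm hm6 hc6, empInfluence, if_neg (by simp [hku])]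
      · simp only [Test.Holds, hr7, hs7.real_zero] at hb
        refine Halts.skip ⟨h6, hs7, ?_⟩
        rwa [pruneStep, if_pos hb]
      · simp only [Test.Holds, hr7, hs7.real_zero] at hb
        refine Halts.op ⟨by simp [h6], hs7.congr (fun r h => by simp) rfl rfl, fun j => ?_⟩
        rw [pruneStep, if_neg hb]
        simp only [apply_store_arr, h6, hs7.nat_four, hm7 j, true_and, Fin.val_inj,
          Finset.mem_erase]
        by_cases h : j = k
        · simp [h, hkk, hkS]
        · simp [h]
      · have : 1 ≤ (p + 1) * (n + 1) := Nat.one_le_iff_ne_zero.2 (by positivity)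
        have : n + 1 ≤ (p + 1) * (n + 1) := Nat.le_mul_of_pos_left _ (by omega)
        nlinarith
    · have hkS : k ∉ S := by
        intro hk
        simp [Test.Holds, h8, hk, hs3.nat_four] at hb
      rw [prunedBelow_succ, if_neg hkS]
      exact (Halts.skip ⟨h6, hs3, hm3⟩ : Halts _ _ _ 1 _).mono (by omega) fun _ h => h
    · have h4 := hs4.nat_four
      refine ⟨by simp [h6, h4, hs4.nat_zero],
        hs4.congr (fun r h => by simp [show r ≠ 6 by omega]) rfl rfl, by simpa using hm4,
        fun j hj => ?_⟩
      rw [prunedBelow_succ, ← hj2 j (by omega)]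
      split_ifs
      · rw [mem_pruneStep (by rintro rfl; omega)]
      · rfl
  · refine ⟨h6, hs1, ?_, ?_⟩
    · simpa [ha1, prunedBelow] using hS
    · simp [prunedBelow]
  · have : ∑ k ∈ Finset.range p, (if s.arr 0 k = 1 then K else 0) = S.card * K := by
      rw [Finset.sum_range]
      simp only [hS _]
      rw [Finset.card_eq_sum_ones, Finset.sum_mul, ← Finset.sum_filter]
      simp
    simp only [Finset.sum_add_distrib, this]
    simp
    omega

/-- The program implements the algorithm, and its running time is linear in the size of the
pseudo-neighborhood and in the size of the input. -/
theorem learnProg_spec (X : Samples p n) (u : Fin p) (hτ : 0 < τ) :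
    ∃ t S R, PseudoNbhd X τ u S ∧ LearnNbhd X τ u R ∧ Returns learnProg X τ u t R ∧
      t ≤ 200 * ((S.card + 1) * (p + 1) * (n + 1)) := by
  have h0 : Halts (inputMatrix X) (block [.const 4 1, .const 5 1]) (initStore p n τ u) 3
      fun s => Env p n u τ s ∧ s.nat 5 = 1 ∧ Marks (s.arr 0) (∅ : Finset (Fin p)) := by
    apply Halts.block
    refine ⟨⟨?_, ?_, ?_, ?_, ?_, ?_, ?_⟩, ?_, ?_⟩ <;> simp [initStore, Marks]
  obtain ⟨t0, s0, hrun0, ht0, hs0, h5, hm0⟩ := h0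
  obtain ⟨t1, s1, S, hrun1, hS, ht1, hs1, hm1⟩ := greedyProg_spec hτ .empty hs0 h5 hm0
  obtain ⟨t2, s2, hrun2, ht2, hm2⟩ :=
    pruneProg_spec (X := X) (hS.1.self_notMem hτ) hs1 hm1
  refine ⟨_, S, _, hS, ⟨S, (List.finRange p).filter (· ∈ S), hS,
    (List.nodup_finRange p).filter _, by ext; simp, rfl⟩,
    ⟨s2, .seq hrun0 (.seq hrun1 hrun2), fun j => ?_⟩, ?_⟩
  · have := hm2 j
    rwa [prunedBelow, List.take_of_length_le (by simp)] at this
  · have : 1 ≤ (p + 1) * (n + 1) := Nat.one_le_iff_ne_zero.2 (by positivity)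
    have : p + 1 ≤ (p + 1) * (n + 1) := Nat.le_mul_of_pos_right _ (by omega)
    simp only [Finset.card_empty, zero_mul, add_zero] at ht1
    nlinarith

end Specs

/-! ### The size of the pseudo-neighborhood -/

/-- The defining property of the conditional mean of `g` given a label `f` on a finite uniform
space. -/
theorem sum_mul_condMean {ι κ : Type*} [Fintype ι] [DecidableEq κ] (f : ι → κ) (g h : ι → ℝ)
    (hh : ∀ s t, f s = f t → h s = h t) :
    ∑ t, h t * ((∑ s, if f s = f t then g s else 0) / ∑ s, if f s = f t then (1 : ℝ) else 0) =
      ∑ t, h t * g t := by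
  have hpos : ∀ t, (0 : ℝ) < ∑ s, if f s = f t then (1 : ℝ) else 0 := fun t =>
    Finset.sum_pos' (fun s _ => by split_ifs <;> norm_num) ⟨t, Finset.mem_univ t, by simp⟩
  simp only [Finset.sum_div, Finset.mul_sum]
  rw [Finset.sum_comm]
  refine Finset.sum_congr rfl fun s _ => ?_
  have : ∀ t, h t * ((if f s = f t then g s else 0) / ∑ s, if f s = f t then (1 : ℝ) else 0) =
      (h s * g s / ∑ r, if f r = f s then (1 : ℝ) else 0) * if f t = f s then 1 else 0 := by
    intro t
    by_cases hst : f s = f t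
    · simp only [hst, if_true, hh s t hst]; ring
    · simp [hst, Ne.symm hst]
  simp only [this]
  rw [← Finset.mul_sum, div_mul_cancel₀ _ (hpos s).ne']

section

variable {p n : ℕ} {X : Samples p n} {S : Finset (Fin p)} {u i : Fin p}

theorem mem_agreeEvent_iff {x y : Config p} :
    y ∈ agreeEvent S x ↔ S.restrict y = S.restrict x := by
  simp [agreeEvent, funext_iff]

theorem agreeEvent_congr {x y : Config p} (h : y ∈ agreeEvent S x) :
    agreeEvent S y = agreeEvent S x := by
  ext z
  rw [mem_agreeEvent_iff, mem_agreeEvent_iff, mem_agreeEvent_iff.1 h]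

open Classical in
theorem empCond_agreeEvent (B : Set (Config p)) (t : Fin n) :
    empCond X B (agreeEvent S (X t)) =
      (∑ s, if S.restrict (X s) = S.restrict (X t) then B.indicator 1 (X s) else 0) /
        ∑ s, if S.restrict (X s) = S.restrict (X t) then (1 : ℝ) else 0 := by
  have hn : (1 / n : ℝ) ≠ 0 := one_div_ne_zero (by exact_mod_cast (Fin.pos t).ne')
  unfold empCond empProb empMean
  rw [mul_div_mul_left _ _ hn]
  congr 1
  · refine Finset.sum_congr rfl fun s _ => ?_
    rw [Set.inter_comm, ← Set.indicator_indicator, Set.indicator_apply]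
    simp only [mem_agreeEvent_iff]
  · refine Finset.sum_congr rfl fun s _ => ?_
    rw [Set.indicator_apply]
    simp only [mem_agreeEvent_iff, Pi.one_apply]

theorem sum_mul_empCond (B : Set (Config p)) (h : Fin n → ℝ)
    (hh : ∀ s t, X s ∈ agreeEvent S (X t) → h s = h t) :
    ∑ t, h t * empCond X B (agreeEvent S (X t)) = ∑ t, h t * B.indicator 1 (X t) := by
  classical
  simp only [empCond_agreeEvent]
  exact sum_mul_condMean (fun t => S.restrict (X t)) (fun t => B.indicator 1 (X t)) h
    fun s t hst => hh s t (mem_agreeEvent_iff.2 hst)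

theorem empProb_nonneg (A : Set (Config p)) : 0 ≤ empProb X A :=
  mul_nonneg (by positivity) (Finset.sum_nonneg fun _ _ => Set.indicator_nonneg (by simp) _)

theorem empProb_mono {A B : Set (Config p)} (h : A ⊆ B) : empProb X A ≤ empProb X B :=
  mul_le_mul_of_nonneg_left (Finset.sum_le_sum fun _ _ =>
    Set.indicator_le_indicator_of_subset h (by simp) _) (by positivity)

theorem empProb_spin_add (A : Set (Config p)) (i : Fin p) :
    empProb X (spinEvent i true ∩ A) + empProb X (spinEvent i false ∩ A) = empProb X A := by
  unfold empProb empMean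
  rw [← mul_add, ← Finset.sum_add_distrib]
  congr 1
  refine Finset.sum_congr rfl fun t _ => ?_
  by_cases hx : X t ∈ A <;> cases h : X t i <;> simp [spinEvent, hx, h]

theorem empCond_nonneg (A B : Set (Config p)) : 0 ≤ empCond X A B :=
  div_nonneg (empProb_nonneg _) (empProb_nonneg _)

theorem empCond_le_one (A B : Set (Config p)) : empCond X A B ≤ 1 :=
  div_le_one_of_le₀ (empProb_mono Set.inter_subset_right) (empProb_nonneg _)

theorem empProb_agreeEvent_pos (t : Fin n) : 0 < empProb X (agreeEvent S (X t)) := by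
  have hn : (0 : ℝ) < n := by exact_mod_cast Fin.pos t
  refine mul_pos (by positivity) (Finset.sum_pos' (fun _ _ => Set.indicator_nonneg (by simp) _)
    ⟨t, Finset.mem_univ t, ?_⟩)
  rw [Set.indicator_of_mem (by simp [agreeEvent])]
  simp

theorem agreeEvent_insert {x : Config p} :
    agreeEvent (insert i S) x = spinEvent i (x i) ∩ agreeEvent S x := by
  ext y
  simp [agreeEvent, spinEvent]

/-- `|P̂(X_u = + | X_i, X_S) - P̂(X_u = + | X_S)|` in terms of the conditional influence. -/
theorem abs_empCond_insert_sub (t : Fin n) :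
    |empCond X (spinEvent u true) (agreeEvent (insert i S) (X t)) -
        empCond X (spinEvent u true) (agreeEvent S (X t))| =
      empCond X (spinEvent i false) (agreeEvent S (X t)) * |empNu X u i S (X t)| *
          (spinEvent i true).indicator 1 (X t) +
        empCond X (spinEvent i true) (agreeEvent S (X t)) * |empNu X u i S (X t)| *
          (spinEvent i false).indicator 1 (X t) := by
  have hpos := empProb_agreeEvent_pos (X := X) (S := insert i S) t
  have hc := empProb_spin_add (X := X) (agreeEvent S (X t)) i
  have ha := empProb_spin_add (X := X) (spinEvent u true ∩ agreeEvent S (X t)) i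
  rw [Set.inter_left_comm, Set.inter_left_comm (spinEvent i false)] at ha
  have hc1 := empProb_nonneg (X := X) (spinEvent i true ∩ agreeEvent S (X t))
  have hc0 := empProb_nonneg (X := X) (spinEvent i false ∩ agreeEvent S (X t))
  have ha1 := empProb_mono (X := X) (Set.inter_subset_right (s := spinEvent u true)
    (t := spinEvent i true ∩ agreeEvent S (X t)))
  have ha0 := empProb_mono (X := X) (Set.inter_subset_right (s := spinEvent u true)
    (t := spinEvent i false ∩ agreeEvent S (X t)))
  have ha1' := empProb_nonneg (X := X) (spinEvent u true ∩ (spinEvent i true ∩ agreeEvent S (X t)))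
  have ha0' := empProb_nonneg (X := X) (spinEvent u true ∩ (spinEvent i false ∩ agreeEvent S (X t)))
  rw [agreeEvent_insert] at hpos ⊢
  simp only [empNu, empCond, ← hc, ← ha]
  cases h : X t i
  · rw [h] at hpos
    have e1 : (spinEvent i true).indicator (1 : Config p → ℝ) (X t) = 0 := by simp [spinEvent, h]
    have e2 : (spinEvent i false).indicator (1 : Config p → ℝ) (X t) = 1 := by simp [spinEvent, h]
    rw [e1, e2]
    generalize empProb X (spinEvent u true ∩ (spinEvent i true ∩ agreeEvent S (X t))) = a1 at *
    generalize empProb X (spinEvent u true ∩ (spinEvent i false ∩ agreeEvent S (X t))) = a0 at *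
    generalize empProb X (spinEvent i true ∩ agreeEvent S (X t)) = c1 at *
    generalize empProb X (spinEvent i false ∩ agreeEvent S (X t)) = c0 at *
    rw [mul_zero, zero_add, mul_one, ← abs_of_nonneg (div_nonneg hc1 (add_nonneg hc1 hc0)),
      ← abs_mul, ← abs_neg]
    congr 1
    rcases eq_or_lt_of_le hc1 with h0 | h0
    · obtain rfl : a1 = 0 := by linarith
      simp [← h0]
    · field_simp; ring
  · rw [h] at hpos
    have e1 : (spinEvent i true).indicator (1 : Config p → ℝ) (X t) = 1 := by simp [spinEvent, h]
    have e2 : (spinEvent i false).indicator (1 : Config p → ℝ) (X t) = 0 := by simp [spinEvent, h]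
    rw [e1, e2]
    generalize empProb X (spinEvent u true ∩ (spinEvent i true ∩ agreeEvent S (X t))) = a1 at *
    generalize empProb X (spinEvent u true ∩ (spinEvent i false ∩ agreeEvent S (X t))) = a0 at *
    generalize empProb X (spinEvent i true ∩ agreeEvent S (X t)) = c1 at *
    generalize empProb X (spinEvent i false ∩ agreeEvent S (X t)) = c0 at *
    rw [mul_zero, add_zero, mul_one, ← abs_of_nonneg (div_nonneg hc0 (add_nonneg hc1 hc0)),
      ← abs_mul]
    congr 1
    rcases eq_or_lt_of_le hc0 with h0 | h0
    · obtain rfl : a0 = 0 := by linarith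
      simp [← h0]
    · field_simp; ring

/-- The empirical mean of the square of `P̂(X_u = + | X_S)`. -/
noncomputable def empEnergy (X : Samples p n) (u : Fin p) (S : Finset (Fin p)) : ℝ :=
  1 / n * ∑ t, empCond X (spinEvent u true) (agreeEvent S (X t)) ^ 2

theorem empEnergy_le_one : empEnergy X u S ≤ 1 := by
  have : ∑ t, empCond X (spinEvent u true) (agreeEvent S (X t)) ^ 2 ≤ ∑ _t : Fin n, (1 : ℝ) :=
    Finset.sum_le_sum fun t _ => pow_le_one₀ (empCond_nonneg _ _) (empCond_le_one _ _)
  rw [Finset.sum_const, Finset.card_univ, Fintype.card_fin, nsmul_eq_mul, mul_one] at this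
  rw [empEnergy, one_div_mul_eq_div]
  exact div_le_one_of_le₀ this (Nat.cast_nonneg n)

theorem empEnergy_nonneg : 0 ≤ empEnergy X u S :=
  mul_nonneg (by positivity) (Finset.sum_nonneg fun _ _ => sq_nonneg _)

theorem sq_empInfluence_le : empInfluence X u i S ^ 2 ≤
    empEnergy X u (insert i S) - empEnergy X u S ∨ empInfluence X u i S = 0 := by
  by_cases hi : i ∈ insert u S
  · right; rw [empInfluence, if_pos hi]
  left
  rcases Nat.eq_zero_or_pos n with rfl | hn
  · simp [empInfluence, empMean, empEnergy]
  have hn' : (0 : ℝ) < n := by exact_mod_cast hn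
  set q' := fun t => empCond X (spinEvent u true) (agreeEvent (insert i S) (X t)) with hq'
  set q := fun t => empCond X (spinEvent u true) (agreeEvent S (X t)) with hq
  have hinv : ∀ s t, X s ∈ agreeEvent S (X t) → q s = q t := fun s t h => by
    simp only [hq, agreeEvent_congr h]
  have hnu : ∀ s t, X s ∈ agreeEvent S (X t) → ∀ b,
      empCond X (spinEvent i b) (agreeEvent S (X s)) * |empNu X u i S (X s)| =
      empCond X (spinEvent i b) (agreeEvent S (X t)) * |empNu X u i S (X t)| := fun s t h b => by
    simp only [empNu, agreeEvent_congr h]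
  have habs : ∑ t, |q' t - q t| = ∑ t, empWeight X i S (X t) * |empNu X u i S (X t)| := by
    simp only [hq', hq, abs_empCond_insert_sub, Finset.sum_add_distrib]
    rw [← sum_mul_empCond (S := S) _ _ (fun s t h => hnu s t h false),
      ← sum_mul_empCond (S := S) _ _ (fun s t h => hnu s t h true), ← Finset.sum_add_distrib]
    refine Finset.sum_congr rfl fun t _ => ?_
    rw [empWeight]; ring
  have hcross : ∑ t, q t * q' t = ∑ t, q t * q t := by
    simp only [hq']
    rw [sum_mul_empCond (S := insert i S) _ q fun s t h => hinv s t ?_]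
    · exact (sum_mul_empCond (S := S) _ q hinv).symm
    · rw [agreeEvent_insert] at h; exact h.2
  have hsq : ∑ t, |q' t - q t| ^ 2 = n * (empEnergy X u (insert i S) - empEnergy X u S) := by
    rw [empEnergy, empEnergy, ← mul_sub, ← mul_assoc, mul_one_div_cancel hn'.ne', one_mul]
    have : ∀ t, |q' t - q t| ^ 2 = q' t ^ 2 - q t ^ 2 - 2 * (q t * q' t - q t * q t) := by
      intro t; rw [sq_abs]; ring
    simp only [this, Finset.sum_sub_distrib, ← Finset.mul_sum, hcross]
    simp [hq', hq]
  have hcs := sq_sum_le_card_mul_sum_sq (s := Finset.univ) (f := fun t => |q' t - q t|)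
  rw [Finset.card_univ, Fintype.card_fin, hsq, habs] at hcs
  rw [empInfluence, if_neg hi, empMean, mul_pow, one_div, inv_pow, inv_mul_le_iff₀ (by positivity)]
  linarith

theorem GreedyReach.card_mul_sq_le {τ : ℝ} (hτ : 0 < τ) (h : GreedyReach X τ u S) :
    S.card * τ ^ 2 ≤ empEnergy X u S := by
  induction h with
  | empty => simpa using empEnergy_nonneg
  | add S i _ _ hi ih =>
    rcases sq_empInfluence_le (X := X) (u := u) (i := i) (S := S) with h | h
    · have h1 : ((insert i S).card : ℝ) ≤ S.card + 1 := by exact_mod_cast Finset.card_insert_le i S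
      have h2 : τ ^ 2 ≤ empInfluence X u i S ^ 2 := pow_le_pow_left₀ hτ.le hi 2
      nlinarith [sq_nonneg τ]
    · linarith

theorem GreedyReach.card_le {τ : ℝ} (hτ : 0 < τ) (h : GreedyReach X τ u S) :
    (S.card : ℝ) ≤ 1 / τ ^ 2 := by
  rw [le_div_iff₀ (by positivity)]
  exact (h.card_mul_sq_le hτ).trans empEnergy_le_one

end

/-! ### Influences as sums of covariances over cylinders -/

section

variable {p n : ℕ} {X : Samples p n} {S : Finset (Fin p)} {u i : Fin p}

/-- The event that the restriction to `S` is `y`. -/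
def cylinder (S : Finset (Fin p)) (y : S → Bool) : Set (Config p) := {x | S.restrict x = y}

theorem agreeEvent_eq_cylinder (x : Config p) : agreeEvent S x = cylinder S (S.restrict x) := by
  ext y
  exact mem_agreeEvent_iff

/-- The (unnormalized) covariance of the events `X_u = +` and `X_i = +` on the event `B`. -/
noncomputable def covGap (m : Set (Config p) → ℝ) (u i : Fin p) (B : Set (Config p)) : ℝ :=
  m (spinEvent u true ∩ (spinEvent i true ∩ B)) -
    m (spinEvent u true ∩ B) * m (spinEvent i true ∩ B) / m B

/-- The average influence in terms of covariances. -/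
noncomputable def cylInfluence (m : Set (Config p) → ℝ) (u i : Fin p) (S : Finset (Fin p)) : ℝ :=
  2 * ∑ y, |covGap m u i (cylinder S y)|

theorem weighted_nu_eq_cov {a₁ a₀ c₁ c₀ : ℝ} (h₁ : 0 ≤ a₁) (h₀ : 0 ≤ a₀) (h₁' : a₁ ≤ c₁)
    (h₀' : a₀ ≤ c₀) :
    (c₁ + c₀) * (2 * (c₁ / (c₁ + c₀)) * (c₀ / (c₁ + c₀)) * |a₁ / c₁ - a₀ / c₀|) =
      2 * |a₁ - (a₁ + a₀) * c₁ / (c₁ + c₀)| := by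
  rcases eq_or_lt_of_le (h₁.trans h₁') with hc₁ | hc₁
  · obtain rfl : a₁ = 0 := by linarith
    simp [← hc₁]
  rcases eq_or_lt_of_le (h₀.trans h₀') with hc₀ | hc₀
  · obtain rfl : a₀ = 0 := by linarith
    simp [← hc₀, hc₁.ne']
  have : a₁ - (a₁ + a₀) * c₁ / (c₁ + c₀) = c₁ * c₀ / (c₁ + c₀) * (a₁ / c₁ - a₀ / c₀) := by
    field_simp
    ring
  have hpos : 0 < c₁ * c₀ / (c₁ + c₀) := by positivity
  rw [this, abs_mul (c₁ * c₀ / (c₁ + c₀)), abs_of_pos hpos]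
  field_simp

open Classical in
theorem empMean_comp_restrict (F : (S → Bool) → ℝ) :
    empMean X (fun x => F (S.restrict x)) = ∑ y, empProb X (cylinder S y) * F y := by
  simp only [empMean, empProb, Finset.mul_sum, Finset.sum_mul]
  rw [Finset.sum_comm]
  refine Finset.sum_congr rfl fun t _ => ?_
  rw [Finset.sum_eq_single (S.restrict (X t))]
  · rw [Set.indicator_of_mem (by simp [cylinder])]
    simp
  · intro y _ hy
    rw [Set.indicator_of_notMem (by simpa [cylinder] using hy.symm)]
    simp
  · simp

theorem empInfluence_eq_cylInfluence (hi : i ∉ insert u S) :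
    empInfluence X u i S = cylInfluence (empProb X) u i S := by
  rw [empInfluence, if_neg hi, cylInfluence, Finset.mul_sum]
  simp only [empWeight, empNu, agreeEvent_eq_cylinder]
  refine (empMean_comp_restrict (fun y => 2 * empCond X (spinEvent i true) (cylinder S y) *
    empCond X (spinEvent i false) (cylinder S y) *
    |empCond X (spinEvent u true) (spinEvent i true ∩ cylinder S y) -
      empCond X (spinEvent u true) (spinEvent i false ∩ cylinder S y)|)).trans ?_
  refine Finset.sum_congr rfl fun y _ => ?_
  have hc := empProb_spin_add (X := X) (cylinder S y) i
  have ha := empProb_spin_add (X := X) (spinEvent u true ∩ cylinder S y) i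
  rw [Set.inter_left_comm, Set.inter_left_comm (spinEvent i false)] at ha
  simp only [empCond, covGap, ← hc, ← ha]
  exact weighted_nu_eq_cov (empProb_nonneg _) (empProb_nonneg _)
    (empProb_mono Set.inter_subset_right) (empProb_mono Set.inter_subset_right)

theorem abs_mul_div_sub_le {a b c a' b' c' γ : ℝ} (hb : 0 ≤ b) (hbc : b ≤ c)
    (ha' : 0 ≤ a') (hac' : a' ≤ c')
    (h₁ : |a - a'| ≤ γ) (h₂ : |b - b'| ≤ γ) (h₃ : |c - c'| ≤ γ) :
    |a * b / c - a' * b' / c'| ≤ 3 * γ := by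
  have hr0 : 0 ≤ b / c := div_nonneg hb (hb.trans hbc)
  have hr1 : b / c ≤ 1 := div_le_one_of_le₀ hbc (hb.trans hbc)
  have hs0 : 0 ≤ a' / c' := div_nonneg ha' (ha'.trans hac')
  have hs1 : a' / c' ≤ 1 := div_le_one_of_le₀ hac' (ha'.trans hac')
  have hbr : b = b / c * c := by
    rcases eq_or_ne c 0 with h | h
    · subst h; simp; linarith
    · field_simp
  have has : a' = a' / c' * c' := by
    rcases eq_or_ne c' 0 with h | h
    · subst h; simp; linarith
    · field_simp
  have key : a * b / c - a' * b' / c' =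
      (a - a') * (b / c) + a' / c' * ((b - b') - b / c * (c - c')) := by
    have e1 : a * b / c = a * (b / c) := by ring
    have e2 : a' * b' / c' = a' / c' * b' := by ring
    rw [e1, e2]
    linear_combination (b / c) * has - a' / c' * hbr
  rw [key]
  have hγ : 0 ≤ γ := (abs_nonneg _).trans h₁
  have b1 : |(a - a') * (b / c)| ≤ γ := by
    rw [abs_mul, abs_of_nonneg hr0]
    exact (mul_le_mul h₁ hr1 hr0 hγ).trans_eq (mul_one _)
  have b2 : |b / c * (c - c')| ≤ γ := by
    rw [abs_mul, abs_of_nonneg hr0]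
    exact (mul_le_mul hr1 h₃ (abs_nonneg _) zero_le_one).trans_eq (one_mul _)
  have b3 : |(b - b') - b / c * (c - c')| ≤ 2 * γ := by
    refine (abs_sub _ _).trans ?_
    linarith
  have b4 : |a' / c' * ((b - b') - b / c * (c - c'))| ≤ 2 * γ := by
    rw [abs_mul, abs_of_nonneg hs0]
    exact (mul_le_mul hs1 b3 (abs_nonneg _) zero_le_one).trans_eq (one_mul _)
  refine (abs_add_le _ _).trans ?_
  linarith

/-- The event that the spins listed in `L` have the listed values. -/
def listCylinder (L : List (Fin p × Bool)) : Set (Config p) := {x | ∀ q ∈ L, x q.1 = q.2}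

theorem spinEvent_inter_listCylinder (i : Fin p) (b : Bool) (L : List (Fin p × Bool)) :
    spinEvent i b ∩ listCylinder L = listCylinder ((i, b) :: L) := by
  ext x
  simp [spinEvent, listCylinder]

theorem cylinder_eq_listCylinder (S : Finset (Fin p)) (y : S → Bool) :
    ∃ L : List (Fin p × Bool), L.length = S.card ∧ cylinder S y = listCylinder L := by
  refine ⟨S.attach.toList.map fun j => (j.1, y j), by simp, ?_⟩
  ext x
  simp only [cylinder, listCylinder, Set.mem_ofPred_eq, funext_iff, List.forall_mem_map,
    Finset.mem_toList, Finset.mem_attach, true_implies, Finset.restrict]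

theorem abs_cylInfluence_sub_le {m m' : Set (Config p) → ℝ} {γ : ℝ} {k : ℕ}
    (hm0 : ∀ A, 0 ≤ m A) (hm : ∀ A B, A ⊆ B → m A ≤ m B)
    (hm0' : ∀ A, 0 ≤ m' A) (hm' : ∀ A B, A ⊆ B → m' A ≤ m' B)
    (h : ∀ L : List (Fin p × Bool), L.length ≤ k → |m (listCylinder L) - m' (listCylinder L)| ≤ γ)
    (hS : S.card + 2 ≤ k) :
    |cylInfluence m u i S - cylInfluence m' u i S| ≤ 8 * 2 ^ S.card * γ := by
  have key : ∀ y : S → Bool,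
      |(|covGap m u i (cylinder S y)| - |covGap m' u i (cylinder S y)|)| ≤ 4 * γ := by
    intro y
    refine (abs_abs_sub_abs_le_abs_sub _ _).trans ?_
    obtain ⟨L, hL, hy⟩ := cylinder_eq_listCylinder S y
    have h1 := h L (by omega)
    have h2 := h ((i, true) :: L) (by simp; omega)
    have h3 := h ((u, true) :: L) (by simp; omega)
    have h4 := h ((u, true) :: (i, true) :: L) (by simp; omega)
    simp only [← spinEvent_inter_listCylinder, ← hy] at h1 h2 h3 h4
    have := abs_mul_div_sub_le (hm0 _) (hm _ _ Set.inter_subset_right) (hm0' _)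
      (hm' _ _ Set.inter_subset_right) h3 h2 h1
    unfold covGap
    rw [sub_sub_sub_comm]
    refine (abs_sub _ _).trans ?_
    linarith
  rw [cylInfluence, cylInfluence, ← mul_sub, ← Finset.sum_sub_distrib, abs_mul, abs_two]
  have := (Finset.abs_sum_le_sum_abs _ _).trans
    (Finset.sum_le_sum fun y (_ : y ∈ (Finset.univ : Finset (S → Bool))) => key y)
  rw [Finset.sum_const, Finset.card_univ, Fintype.card_fun, Fintype.card_bool, Fintype.card_coe,
    nsmul_eq_mul, Nat.cast_pow, Nat.cast_ofNat] at this
  linarith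

end

/-! ### Concentration of the empirical cylinder probabilities -/

section

variable {p n : ℕ}

theorem hoeffding_pi {Ω : Type*} [MeasurableSpace Ω] (μ : Measure Ω) [IsProbabilityMeasure μ]
    {f : Ω → ℝ} (hf : Measurable f) {a b : ℝ} (hab : b - a = 1) (hf' : ∀ x, f x ∈ Set.Icc a b)
    {γ : ℝ} (hγ : 0 ≤ γ) (hn : 0 < n) :
    (Measure.pi fun _ : Fin n => μ).real {X | n * γ ≤ ∑ t, (f (X t) - ∫ x, f x ∂μ)} ≤
      Real.exp (-(2 * n * γ ^ 2)) := by
  have hind : ProbabilityTheory.iIndepFun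
      (fun (t : Fin n) (X : Fin n → Ω) => f (X t) - ∫ x, f x ∂μ) (Measure.pi fun _ => μ) :=
    ProbabilityTheory.iIndepFun_pi (X := fun _ x => f x - ∫ x, f x ∂μ)
      fun _ => (hf.sub_const _).aemeasurable
  have hsub : ∀ t ∈ (Finset.univ : Finset (Fin n)), ProbabilityTheory.HasSubgaussianMGF
      (fun X : Fin n → Ω => f (X t) - ∫ x, f x ∂μ) ((‖b - a‖₊ / 2) ^ 2)
      (Measure.pi fun _ => μ) := by
    intro t _
    have hint : ∫ X : Fin n → Ω, f (X t) ∂(Measure.pi fun _ => μ) = ∫ x, f x ∂μ :=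
      integral_comp_eval (μ := fun _ : Fin n => μ) hf.aestronglyMeasurable
    rw [← hint]
    exact ProbabilityTheory.hasSubgaussianMGF_of_mem_Icc
      (hf.comp (measurable_pi_apply t)).aemeasurable (Filter.Eventually.of_forall fun X => hf' _)
  have hn' : (0 : ℝ) < n := by exact_mod_cast hn
  refine (ProbabilityTheory.HasSubgaussianMGF.measure_sum_ge_le_of_iIndepFun hind hsub
    (mul_nonneg hn'.le hγ)).trans_eq ?_
  congr 1
  simp only [hab, Finset.sum_const, Finset.card_univ, Fintype.card_fin, nnnorm_one,
    nsmul_eq_mul, NNReal.coe_mul, NNReal.coe_natCast, NNReal.coe_pow, NNReal.coe_div,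
    NNReal.coe_one, NNReal.coe_ofNat]
  field_simp

theorem measure_abs_empProb_sub_le (μ : Measure (Config p)) [IsProbabilityMeasure μ]
    (A : Set (Config p)) {γ : ℝ} (hγ : 0 ≤ γ) (hn : 0 < n) :
    (Measure.pi fun _ : Fin n => μ).real {X | γ ≤ |empProb X A - μ.real A|} ≤
      2 * Real.exp (-(2 * n * γ ^ 2)) := by
  have hA : MeasurableSet A := A.toFinite.measurableSet
  have hn' : (0 : ℝ) < n := by exact_mod_cast hn
  have hmeas : Measurable (A.indicator (1 : Config p → ℝ)) := measurable_one.indicator hA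
  have hint : ∫ x, A.indicator (1 : Config p → ℝ) x ∂μ = μ.real A := integral_indicator_one hA
  have hsum : ∀ X : Samples p n, ∑ t, (A.indicator (1 : Config p → ℝ) (X t) - μ.real A) =
      n * (empProb X A - μ.real A) := by
    intro X
    rw [Finset.sum_sub_distrib, empProb, empMean, mul_sub, ← mul_assoc,
      mul_one_div_cancel hn'.ne']
    simp
  have h1 : (Measure.pi fun _ : Fin n => μ).real
      {X | n * γ ≤ n * (empProb X A - μ.real A)} ≤ Real.exp (-(2 * n * γ ^ 2)) := by
    have h := hoeffding_pi μ hmeas (a := 0) (b := 1) (by norm_num) (fun x =>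
      ⟨Set.indicator_nonneg (by simp) _, Set.indicator_le_self' (by simp) _⟩) hγ hn
    rw [hint] at h
    simpa only [hsum] using h
  have h2 : (Measure.pi fun _ : Fin n => μ).real
      {X | n * γ ≤ -(n * (empProb X A - μ.real A))} ≤ Real.exp (-(2 * n * γ ^ 2)) := by
    have h := hoeffding_pi μ (f := fun x => -A.indicator (1 : Config p → ℝ) x) hmeas.neg
      (a := -1) (b := 0) (by norm_num) (fun x =>
      ⟨neg_le_neg (Set.indicator_le_self' (by simp) _),
        neg_nonpos.2 (Set.indicator_nonneg (by simp) _)⟩) hγ hn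
    rw [integral_neg, hint] at h
    simpa only [← hsum, ← Finset.sum_neg_distrib, neg_sub_left, neg_sub, sub_neg_eq_add,
      neg_add_eq_sub] using h
  have hsub : {X : Samples p n | γ ≤ |empProb X A - μ.real A|} ⊆
      {X | n * γ ≤ n * (empProb X A - μ.real A)} ∪
        {X | n * γ ≤ -(n * (empProb X A - μ.real A))} := by
    intro X hX
    rw [Set.mem_ofPred_eq] at hX
    rcases le_abs.1 hX with h | h
    · exact Or.inl (mul_le_mul_of_nonneg_left h hn'.le)
    · right
      change (n : ℝ) * γ ≤ -(n * (empProb X A - μ.real A))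
      rw [← mul_neg]
      exact mul_le_mul_of_nonneg_left h hn'.le
  exact (measureReal_mono hsub).trans
    ((measureReal_union_le _ _).trans ((add_le_add h1 h2).trans_eq (by ring)))

/-- The samples whose empirical probabilities of all cylinders of size at most `k` are off by
less than `γ`. -/
def goodSamples (μ : Measure (Config p)) (n k : ℕ) (γ : ℝ) : Set (Samples p n) :=
  {X | ∀ L : List (Fin p × Bool), L.length ≤ k →
    |empProb X (listCylinder L) - μ.real (listCylinder L)| < γ}

theorem measure_goodSamples (μ : Measure (Config p)) [IsProbabilityMeasure μ] (k : ℕ) {γ : ℝ}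
    (hγ : 0 ≤ γ) (hn : 0 < n) :
    1 - (2 * p + 1) ^ k * (2 * Real.exp (-(2 * n * γ ^ 2))) ≤
      (Measure.pi fun _ : Fin n => μ).real (goodSamples μ n k γ) := by
  classical
  set P := Measure.pi fun _ : Fin n => μ
  let cyl : (Fin k → Option (Fin p × Bool)) → Set (Config p) :=
    fun f => {x | ∀ j, ∀ q ∈ f j, x q.1 = q.2}
  have hcyl : ∀ L : List (Fin p × Bool), L.length ≤ k → ∃ f, cyl f = listCylinder L := by
    intro L hL
    refine ⟨fun j => L[(j : ℕ)]?, ?_⟩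
    ext x
    simp only [cyl, listCylinder, Set.mem_ofPred_eq]
    constructor
    · intro h q hq
      obtain ⟨j, hj, rfl⟩ := List.mem_iff_getElem.1 hq
      exact h ⟨j, by omega⟩ _ (by simp [hj])
    · intro h j q hq
      exact h q (List.mem_of_getElem? hq)
  have hsub : (goodSamples μ n k γ)ᶜ ⊆ ⋃ f, {X | γ ≤ |empProb X (cyl f) - μ.real (cyl f)|} := by
    intro X hX
    simp only [goodSamples, Set.mem_compl_iff, Set.mem_ofPred_eq, not_forall, not_lt] at hX
    obtain ⟨L, hL, h⟩ := hX
    obtain ⟨f, hf⟩ := hcyl L hL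
    exact Set.mem_iUnion.2 ⟨f, by simpa [hf] using h⟩
  have hbad : P.real (goodSamples μ n k γ)ᶜ ≤
      (2 * p + 1) ^ k * (2 * Real.exp (-(2 * n * γ ^ 2))) := by
    refine (measureReal_mono hsub).trans ((measureReal_iUnion_fintype_le _).trans
      ((Finset.sum_le_sum fun f _ => measure_abs_empProb_sub_le μ (cyl f) hγ hn).trans_eq ?_))
    rw [Finset.sum_const, Finset.card_univ]
    simp [mul_comm]
  rw [measureReal_compl (Set.toFinite _).measurableSet] at hbad
  simp only [probReal_univ] at hbad
  linarith

end

/-! ### Influences in the Ising model -/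

/-- The indicator of a spin being `+`. -/
def plus (b : Bool) : ℝ := if b then 1 else 0

theorem spin_eq (b : Bool) : spin b = 2 * plus b - 1 := by
  cases b <;> norm_num [spin, plus]

theorem spin_not (b : Bool) : spin (!b) = -spin b := by
  cases b <;> norm_num [spin]

/-- The configuration with the spin at `u` reversed. -/
def flip {p : ℕ} (u : Fin p) (x : Config p) : Config p := Function.update x u (!x u)

section

variable {p : ℕ} {u i : Fin p} {x : Config p}

@[simp] theorem flip_self : flip u x u = !x u := by simp [flip]

@[simp] theorem flip_of_ne (h : i ≠ u) : flip u x i = x i := by simp [flip, h]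

theorem flip_involutive (u : Fin p) : Function.Involutive (flip u) := by
  intro x
  ext j
  by_cases h : j = u
  · subst h; simp
  · simp [h]

theorem sum_flip (u : Fin p) (f : Config p → ℝ) : ∑ x, f (flip u x) = ∑ x, f x :=
  Equiv.sum_comp (flip_involutive u).toPerm f

/-- The logistic function of `2 a`. -/
noncomputable def logis (a : ℝ) : ℝ := Real.exp a / (Real.exp a + Real.exp (-a))

theorem logis_sub_ge {M a b : ℝ} (ha : |a| ≤ M) (hb : |b| ≤ M) (hab : b ≤ a) :
    1 / 2 * Real.exp (-2 * M) * (a - b) ≤ logis a - logis b := by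
  have hca : Real.exp a + Real.exp (-a) ≤ 2 * Real.exp M := by
    have h1 := Real.exp_le_exp.2 (le_of_abs_le ha)
    have h2 := Real.exp_le_exp.2 (neg_le.1 (neg_le_of_abs_le ha))
    linarith
  have hcb : Real.exp b + Real.exp (-b) ≤ 2 * Real.exp M := by
    have h1 := Real.exp_le_exp.2 (le_of_abs_le hb)
    have h2 := Real.exp_le_exp.2 (neg_le.1 (neg_le_of_abs_le hb))
    linarith
  have hs : a - b ≤ Real.sinh (a - b) := Real.self_le_sinh_iff.2 (by linarith)
  have key : logis a - logis b = 2 * Real.sinh (a - b) /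
      ((Real.exp a + Real.exp (-a)) * (Real.exp b + Real.exp (-b))) := by
    have h1 : Real.exp a + Real.exp (-a) ≠ 0 := by positivity
    have h2 : Real.exp b + Real.exp (-b) ≠ 0 := by positivity
    rw [logis, logis, Real.sinh_eq, neg_sub, Real.exp_sub, Real.exp_sub]
    simp only [Real.exp_neg]
    have := Real.exp_pos a
    have := Real.exp_pos b
    field_simp
    ring
  rw [key, le_div_iff₀ (by positivity)]
  have hM : Real.exp (-2 * M) * (2 * Real.exp M * (2 * Real.exp M)) = 4 := by
    rw [show 2 * Real.exp M * (2 * Real.exp M) = 4 * (Real.exp M * Real.exp M) by ring,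
      ← Real.exp_add, mul_left_comm, ← Real.exp_add, show -2 * M + (M + M) = 0 by ring,
      Real.exp_zero, mul_one]
  have hprod : (Real.exp a + Real.exp (-a)) * (Real.exp b + Real.exp (-b)) ≤
      2 * Real.exp M * (2 * Real.exp M) := mul_le_mul hca hcb (by positivity) (by positivity)
  calc 1 / 2 * Real.exp (-2 * M) * (a - b) *
        ((Real.exp a + Real.exp (-a)) * (Real.exp b + Real.exp (-b)))
      ≤ 1 / 2 * Real.exp (-2 * M) * (a - b) * (2 * Real.exp M * (2 * Real.exp M)) :=
        mul_le_mul_of_nonneg_left hprod (mul_nonneg (by positivity) (by linarith))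
    _ = 2 * (a - b) := by linear_combination (1 / 2 * (a - b)) * hM
    _ ≤ 2 * Real.sinh (a - b) := by linarith

theorem logis_sub_mul_sub_ge {M a b : ℝ} (ha : |a| ≤ M) (hb : |b| ≤ M) :
    1 / 2 * Real.exp (-2 * M) * (a - b) ^ 2 ≤ (logis a - logis b) * (a - b) := by
  rcases le_total b a with h | h
  · nlinarith [logis_sub_ge ha hb h]
  · nlinarith [logis_sub_ge hb ha h]

/-- The field acting on the spin at `u`. -/
noncomputable def Param.localField (θ : Param p) (u : Fin p) (x : Config p) : ℝ :=
  ∑ j, θ.coupling u j * spin (x j) + θ.field u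

/-- The probability of a configuration. -/
noncomputable def Param.mass (θ : Param p) (x : Config p) : ℝ :=
  Real.exp (θ.energy x) / θ.partition

variable {θ : Param p}

theorem Param.mass_pos (θ : Param p) (x : Config p) : 0 < θ.mass x :=
  div_pos (Real.exp_pos _) θ.partition_pos

theorem Param.real_toMeasure (θ : Param p) (A : Set (Config p)) :
    θ.pmf.toMeasure.real A = ∑ x, A.indicator θ.mass x := by
  rw [measureReal_def, PMF.toMeasure_apply_fintype, ENNReal.toReal_sum]
  · refine Finset.sum_congr rfl fun x _ => ?_
    by_cases hx : x ∈ A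
    · simp only [Set.indicator_of_mem hx, Param.pmf, PMF.ofFintype_apply]
      exact ENNReal.toReal_ofReal (θ.mass_pos x).le
    · simp [Set.indicator_of_notMem hx]
  · intro x _
    by_cases hx : x ∈ A
    · rw [Set.indicator_of_mem hx]; exact θ.pmf.apply_ne_top x
    · simp [Set.indicator_of_notMem hx]

theorem energy_flip (hdiag : ∀ i, θ.coupling i i = 0) (u : Fin p) (x : Config p) :
    θ.energy (flip u x) = θ.energy x - 2 * (spin (x u) * θ.localField u x) := by
  have hpair : ∀ i j : Fin p, i < j →
      θ.coupling i j * (spin (x i) * spin (x j)) -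
        θ.coupling i j * (spin (flip u x i) * spin (flip u x j)) =
      (if i = u then 2 * (spin (x u) * (θ.coupling u j * spin (x j))) else 0) +
        (if j = u then 2 * (spin (x u) * (θ.coupling u i * spin (x i))) else 0) := by
    intro i j hij
    by_cases hi : i = u
    · subst hi
      have hj : j ≠ i := hij.ne'
      simp [hj, spin_not]; ring
    · by_cases hj : j = u
      · subst hj
        simp [hi, spin_not, θ.symm i j]; ring
      · simp [hi, hj]
  have hpairs : (∑ q : Fin p × Fin p with q.1 < q.2,
        θ.coupling q.1 q.2 * (spin (x q.1) * spin (x q.2))) -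
      (∑ q : Fin p × Fin p with q.1 < q.2,
        θ.coupling q.1 q.2 * (spin (flip u x q.1) * spin (flip u x q.2))) =
      2 * (spin (x u) * ∑ j, θ.coupling u j * spin (x j)) := by
    rw [← Finset.sum_sub_distrib, Finset.sum_congr rfl fun q hq =>
      hpair q.1 q.2 (Finset.mem_filter.1 hq).2, Finset.sum_add_distrib, Finset.sum_filter,
      Finset.sum_filter, Fintype.sum_prod_type, Fintype.sum_prod_type_right]
    simp only [← ite_and]
    simp only [and_comm (b := _ = u), ite_and]
    rw [Finset.sum_comm]
    simp only [Finset.sum_ite_eq', Finset.mem_univ, if_true]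
    rw [Finset.mul_sum, Finset.mul_sum]
    rw [Finset.sum_comm]
    simp only [Finset.sum_ite_eq', Finset.mem_univ, if_true]
    rw [← Finset.sum_add_distrib]
    refine Finset.sum_congr rfl fun j _ => ?_
    rcases lt_trichotomy u j with h | h | h
    · simp [h, h.not_gt]
    · subst h; simp [hdiag]
    · simp [h, h.not_gt]
  have hfield : (∑ i, θ.field i * spin (x i)) - ∑ i, θ.field i * spin (flip u x i) =
      2 * (spin (x u) * θ.field u) := by
    rw [← Finset.sum_sub_distrib, Finset.sum_eq_single u]
    · simp [spin_not]; ring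
    · intro j _ hj; simp [hj]
    · simp
  rw [Param.energy, Param.energy, Param.localField]
  linear_combination -hpairs - hfield

theorem localField_flip (hdiag : ∀ i, θ.coupling i i = 0) (u : Fin p) (x : Config p) :
    θ.localField u (flip u x) = θ.localField u x := by
  unfold Param.localField
  congr 1
  refine Finset.sum_congr rfl fun j _ => ?_
  by_cases h : j = u
  · subst h; simp [hdiag]
  · simp [h]

theorem mass_flip (hdiag : ∀ i, θ.coupling i i = 0) (u : Fin p) (x : Config p) :
    θ.mass (flip u x) = θ.mass x * Real.exp (-2 * (spin (x u) * θ.localField u x)) := by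
  rw [Param.mass, Param.mass, energy_flip hdiag, sub_eq_add_neg, Real.exp_add, neg_mul]
  ring

theorem mass_flip_ge (hdiag : ∀ i, θ.coupling i i = 0) {M : ℝ}
    (hM : ∀ u x, |θ.localField u x| ≤ M) (u : Fin p) (x : Config p) :
    Real.exp (-2 * M) * θ.mass x ≤ θ.mass (flip u x) := by
  rw [mass_flip hdiag, mul_comm]
  refine mul_le_mul_of_nonneg_left (Real.exp_le_exp.2 ?_) (θ.mass_pos x).le
  have h := abs_le.1 (hM u x)
  cases x u <;> simp only [spin] <;> norm_num <;> linarith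

/-- The conditional probability of `X_u = +` given the other spins is a logistic function of the
local field. -/
theorem sum_mass_mul_plus (hdiag : ∀ i, θ.coupling i i = 0) (u : Fin p) {F : Config p → ℝ}
    (hF : ∀ x, F (flip u x) = F x) :
    ∑ x, θ.mass x * F x * plus (x u) = ∑ x, θ.mass x * F x * logis (θ.localField u x) := by
  rw [← sub_eq_zero, ← Finset.sum_sub_distrib]
  set φ := fun x => θ.mass x * F x * plus (x u) - θ.mass x * F x * logis (θ.localField u x)
    with hφ
  have h0 : ∀ x, φ x + φ (flip u x) = 0 := by
    intro x
    simp only [hφ, hF, localField_flip hdiag, mass_flip hdiag, flip_self, logis]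
    generalize θ.localField u x = g
    have hg := Real.exp_pos g
    have hne : Real.exp g + (Real.exp g)⁻¹ ≠ 0 := by positivity
    have hne' : Real.exp g ^ 2 + 1 ≠ 0 := by positivity
    cases x u
    · have : Real.exp (-2 * (spin false * g)) = Real.exp g ^ 2 := by
        rw [← Real.exp_nat_mul]; congr 1; simp [spin]
      rw [this]
      simp only [plus, Real.exp_neg]
      norm_num
      field_simp
      ring
    · have : Real.exp (-2 * (spin true * g)) = (Real.exp g ^ 2)⁻¹ := by
        rw [← Real.exp_nat_mul, ← Real.exp_neg]; congr 1; simp [spin]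
      rw [this]
      simp only [plus, Real.exp_neg]
      norm_num
      field_simp
      ring
  have h1 : ∑ x, φ x + ∑ x, φ x = 0 := by
    nth_rewrite 2 [← sum_flip u φ]
    rw [← Finset.sum_add_distrib]
    exact Finset.sum_eq_zero fun x _ => h0 x
  linarith

theorem indicator_mass_inter_spin (B : Set (Config p)) (x : Config p) :
    (spinEvent u true ∩ B).indicator θ.mass x = B.indicator θ.mass x * plus (x u) := by
  by_cases hx : x ∈ B <;> cases h : x u <;> simp [spinEvent, plus, hx, h]

theorem sum_indicator_mass_mul_plus (hdiag : ∀ i, θ.coupling i i = 0) (u : Fin p)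
    {B : Set (Config p)} (hB : ∀ x, flip u x ∈ B ↔ x ∈ B) {F : Config p → ℝ}
    (hF : ∀ x, F (flip u x) = F x) :
    ∑ x, B.indicator θ.mass x * F x * plus (x u) =
      ∑ x, B.indicator θ.mass x * F x * logis (θ.localField u x) := by
  classical
  have h := sum_mass_mul_plus hdiag u (F := fun x => B.indicator F x) (fun x => by
    simp only [Set.indicator_apply, hB, hF])
  have hx : ∀ x, B.indicator θ.mass x * F x = θ.mass x * B.indicator F x := fun x => by
    by_cases hx : x ∈ B <;> simp [hx]
  simpa only [hx] using h

variable {S : Finset (Fin p)}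

theorem flip_mem_cylinder (hu : u ∉ S) (y : S → Bool) (x : Config p) :
    flip u x ∈ cylinder S y ↔ x ∈ cylinder S y := by
  have : S.restrict (flip u x) = S.restrict x := by
    ext j
    exact flip_of_ne (by rintro rfl; exact hu j.2)
  simp only [cylinder, Set.mem_ofPred_eq, this]

theorem exists_mem_cylinder (y : S → Bool) : ∃ x, x ∈ cylinder S y :=
  ⟨fun j => if h : j ∈ S then y ⟨j, h⟩ else false, by ext j; simp⟩

theorem eq_of_mem_cylinder {y : S → Bool} {x x' : Config p} (hx : x ∈ cylinder S y)
    (hx' : x' ∈ cylinder S y) {j : Fin p} (hj : j ∈ S) : x j = x' j :=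
  congrFun (hx.trans hx'.symm) ⟨j, hj⟩

theorem sum_indicator_cylinder_pos (y : S → Bool) :
    0 < ∑ x, (cylinder S y).indicator θ.mass x := by
  obtain ⟨x, hx⟩ := exists_mem_cylinder y
  exact Finset.sum_pos' (fun x _ => Set.indicator_nonneg (fun x _ => (θ.mass_pos x).le) x)
    ⟨x, Finset.mem_univ x, by rw [Set.indicator_of_mem hx]; exact θ.mass_pos x⟩

theorem covGap_toMeasure (y : S → Bool) :
    covGap θ.pmf.toMeasure.real u i (cylinder S y) =
      ∑ x, (cylinder S y).indicator θ.mass x * plus (x i) * plus (x u) -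
        (∑ x, (cylinder S y).indicator θ.mass x * 1 * plus (x u)) *
          (∑ x, (cylinder S y).indicator θ.mass x * plus (x i)) /
          ∑ x, (cylinder S y).indicator θ.mass x := by
  simp only [covGap, Param.real_toMeasure, indicator_mass_inter_spin, mul_one]

theorem covGap_eq_zero (hdiag : ∀ i, θ.coupling i i = 0) (hu : u ∉ S) (hiu : i ≠ u)
    (hN : ∀ j ∉ S, θ.coupling u j = 0) (y : S → Bool) :
    covGap θ.pmf.toMeasure.real u i (cylinder S y) = 0 := by
  obtain ⟨x₀, hx₀⟩ := exists_mem_cylinder y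
  have hc := (sum_indicator_cylinder_pos (θ := θ) y).ne'
  have hloc : ∀ x ∈ cylinder S y, θ.localField u x = θ.localField u x₀ := by
    intro x hx
    unfold Param.localField
    congr 1
    refine Finset.sum_congr rfl fun j _ => ?_
    by_cases hj : j ∈ S
    · rw [eq_of_mem_cylinder hx hx₀ hj]
    · simp [hN j hj]
  have key : ∀ F : Config p → ℝ, (∀ x, F (flip u x) = F x) →
      ∑ x, (cylinder S y).indicator θ.mass x * F x * plus (x u) =
        (∑ x, (cylinder S y).indicator θ.mass x * F x) * logis (θ.localField u x₀) := by
    intro F hF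
    rw [sum_indicator_mass_mul_plus hdiag u (flip_mem_cylinder hu y) hF, Finset.sum_mul]
    refine Finset.sum_congr rfl fun x _ => ?_
    by_cases hx : x ∈ cylinder S y
    · rw [hloc x hx]
    · simp [hx]
  rw [covGap_toMeasure, key _ (fun x => by rw [flip_of_ne hiu]), key (fun _ => 1) fun _ => rfl]
  simp only [mul_one]
  field_simp
  ring

theorem cylInfluence_eq_zero (hdiag : ∀ i, θ.coupling i i = 0) (hu : u ∉ S) (hiu : i ≠ u)
    (hN : ∀ j ∉ S, θ.coupling u j = 0) : cylInfluence θ.pmf.toMeasure.real u i S = 0 := by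
  simp [cylInfluence, covGap_eq_zero hdiag hu hiu hN]

end

section

variable {p : ℕ} {u i : Fin p} {x : Config p} {θ : Param p} {S : Finset (Fin p)}

/-- The covariance of two functions under an unnormalized finite weight, as a double sum. -/
theorem two_mul_cov_eq {ι : Type*} [Fintype ι] (w f g : ι → ℝ) :
    2 * ((∑ x, w x) * (∑ x, w x * g x * f x) - (∑ x, w x * f x) * ∑ x, w x * g x) =
      ∑ x, ∑ x', w x * w x' * ((f x - f x') * (g x - g x')) := by
  have h : ∀ x x', w x * w x' * ((f x - f x') * (g x - g x')) =
      (w x * g x * f x) * w x' + w x * (w x' * g x' * f x') - (w x * f x) * (w x' * g x') -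
        (w x * g x) * (w x' * f x') := fun x x' => by ring
  simp only [h, Finset.sum_add_distrib, Finset.sum_sub_distrib, ← Finset.sum_mul_sum]
  ring

theorem localField_sub (T : Finset (Fin p)) (hT : ∀ j, j ∉ S → j ∉ T → θ.coupling u j = 0)
    {y : S → Bool} {x x' : Config p} (hx : x ∈ cylinder S y)
    (hx' : x' ∈ cylinder S y) :
    θ.localField u x - θ.localField u x' =
      2 * (∑ j ∈ T, θ.coupling u j * plus (x j) - ∑ j ∈ T, θ.coupling u j * plus (x' j)) := by
  unfold Param.localField
  rw [add_sub_add_right_eq_sub, ← Finset.sum_sub_distrib, ← Finset.sum_sub_distrib,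
    Finset.mul_sum, ← Finset.sum_subset (Finset.subset_univ T)]
  · refine Finset.sum_congr rfl fun j _ => ?_
    rw [spin_eq, spin_eq]; ring
  · intro j _ hj
    by_cases hjS : j ∈ S
    · rw [eq_of_mem_cylinder hx hx' hjS, sub_self]
    · rw [hT j hjS hj]; ring

/-- A lower bound for the variation of a function that depends on a spin of bounded bias. -/
theorem sum_sq_sub_ge (hdiag : ∀ i, θ.coupling i i = 0) {M : ℝ} (hM0 : 0 ≤ M)
    (hM : ∀ u x, |θ.localField u x| ≤ M) (hi : i ∉ S) (y : S → Bool) {G : Config p → ℝ} {a : ℝ}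
    (hG : ∀ x, a ^ 2 ≤ (G x - G (flip i x)) ^ 2) (b : ℝ) :
    1 / 4 * Real.exp (-2 * M) * a ^ 2 * ∑ x, (cylinder S y).indicator θ.mass x ≤
      ∑ x, (cylinder S y).indicator θ.mass x * (G x - b) ^ 2 := by
  classical
  set w := (cylinder S y).indicator θ.mass with hw
  have hw0 : ∀ x, 0 ≤ w x := fun x => Set.indicator_nonneg (fun x _ => (θ.mass_pos x).le) x
  have he : Real.exp (-2 * M) ≤ 1 := Real.exp_le_one_iff.2 (by linarith)
  have hflip : ∀ x, Real.exp (-2 * M) * w x ≤ w (flip i x) := by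
    intro x
    simp only [hw, Set.indicator_apply, flip_mem_cylinder hi]
    split_ifs
    · exact mass_flip_ge hdiag hM i x
    · simp
  have key : ∀ x, 1 / 2 * Real.exp (-2 * M) * a ^ 2 * w x ≤
      w x * (G x - b) ^ 2 + w (flip i x) * (G (flip i x) - b) ^ 2 := by
    intro x
    have h1 : 1 / 2 * a ^ 2 ≤ (G x - b) ^ 2 + (G (flip i x) - b) ^ 2 := by
      nlinarith [hG x, sq_nonneg (G x - b + (G (flip i x) - b))]
    have h2 : Real.exp (-2 * M) * w x ≤ w x := mul_le_of_le_one_left (hw0 x) he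
    have h3 := mul_le_mul_of_nonneg_right h2 (sq_nonneg (G x - b))
    have h4 := mul_le_mul_of_nonneg_right (hflip x) (sq_nonneg (G (flip i x) - b))
    have h5 := mul_le_mul_of_nonneg_left h1 (mul_nonneg (Real.exp_pos (-2 * M)).le (hw0 x))
    linarith
  have hsum := Finset.sum_le_sum fun x (_ : x ∈ Finset.univ) => key x
  rw [← Finset.mul_sum, Finset.sum_add_distrib,
    sum_flip i fun x => w x * (G x - b) ^ 2] at hsum
  linarith

theorem sum_coupling_mul_covGap_ge (hdiag : ∀ i, θ.coupling i i = 0) {M α : ℝ} (hM0 : 0 ≤ M)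
    (hα : 0 ≤ α) (hM : ∀ u x, |θ.localField u x| ≤ M) (hu : u ∉ S) {T : Finset (Fin p)}
    (huT : u ∉ T) (hT : ∀ j, j ∉ S → j ∉ T → θ.coupling u j = 0) (hST : Disjoint S T)
    (hi : i ∈ T) (hαi : α ≤ |θ.coupling u i|) (y : S → Bool) :
    1 / 8 * Real.exp (-2 * M) ^ 2 * α ^ 2 * ∑ x, (cylinder S y).indicator θ.mass x ≤
      ∑ j ∈ T, θ.coupling u j * covGap θ.pmf.toMeasure.real u j (cylinder S y) := by
  set w := (cylinder S y).indicator θ.mass with hw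
  have hw0 : ∀ x, 0 ≤ w x := fun x => Set.indicator_nonneg (fun x _ => (θ.mass_pos x).le) x
  have hc : 0 < ∑ x, w x := sum_indicator_cylinder_pos y
  set G : Config p → ℝ := fun x => ∑ j ∈ T, θ.coupling u j * plus (x j) with hG
  set q : Config p → ℝ := fun x => logis (θ.localField u x) with hq
  have hGflip : ∀ x, G (flip u x) = G x := fun x =>
    Finset.sum_congr rfl fun j hj => by rw [flip_of_ne (by rintro rfl; exact huT hj)]
  have hGi : ∀ x, α ^ 2 ≤ (G x - G (flip i x)) ^ 2 := by
    intro x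
    have : G x - G (flip i x) = θ.coupling u i * (plus (x i) - plus (!x i)) := by
      simp only [hG]
      rw [← Finset.sum_sub_distrib, Finset.sum_eq_single_of_mem i hi]
      · rw [flip_self]; ring
      · intro j _ hj; rw [flip_of_ne hj, sub_self]
    rw [this, mul_pow, ← sq_abs (θ.coupling u i)]
    have h1 : (plus (x i) - plus (!x i)) ^ 2 = 1 := by cases x i <;> norm_num [plus]
    rw [h1, mul_one]
    exact pow_le_pow_left₀ hα hαi 2
  have hcov : (∑ x, w x) * ∑ j ∈ T, θ.coupling u j *
      covGap θ.pmf.toMeasure.real u j (cylinder S y) =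
      (∑ x, w x) * (∑ x, w x * G x * q x) - (∑ x, w x * q x) * ∑ x, w x * G x := by
    have h1 : ∑ x, w x * G x * q x = ∑ j ∈ T, θ.coupling u j * ∑ x, w x * plus (x j) * plus (x u) := by
      rw [hw, hq, ← sum_indicator_mass_mul_plus hdiag u (flip_mem_cylinder hu y) hGflip]
      simp only [hG, Finset.mul_sum, Finset.sum_mul]
      rw [Finset.sum_comm]
      exact Finset.sum_congr rfl fun j _ => Finset.sum_congr rfl fun x _ => by ring
    have h2 : ∑ x, w x * q x = ∑ x, w x * 1 * plus (x u) := by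
      rw [hw, hq, sum_indicator_mass_mul_plus hdiag u (flip_mem_cylinder hu y)
        (F := fun _ => 1) fun _ => rfl]
      simp
    have h3 : ∑ x, w x * G x = ∑ j ∈ T, θ.coupling u j * ∑ x, w x * plus (x j) := by
      simp only [hG, Finset.mul_sum]
      rw [Finset.sum_comm]
      exact Finset.sum_congr rfl fun j _ => Finset.sum_congr rfl fun x _ => by ring
    rw [h1, h2, h3]
    simp only [covGap_toMeasure, Finset.mul_sum (s := T)]
    rw [← Finset.sum_sub_distrib]
    refine Finset.sum_congr rfl fun j _ => ?_
    rw [← hw]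
    field_simp
  have hpair : ∀ x x', Real.exp (-2 * M) * (w x * w x' * (G x - G x') ^ 2) ≤
      w x * w x' * ((q x - q x') * (G x - G x')) := by
    intro x x'
    by_cases hx : x ∈ cylinder S y
    · by_cases hx' : x' ∈ cylinder S y
      · have h1 := localField_sub T hT hx hx'
        have h2 := logis_sub_mul_sub_ge (hM u x) (hM u x')
        rw [h1] at h2
        have h3 : Real.exp (-2 * M) * (G x - G x') ^ 2 ≤ (q x - q x') * (G x - G x') := by
          simp only [hG, hq]
          nlinarith
        have := mul_le_mul_of_nonneg_left h3 (mul_nonneg (hw0 x) (hw0 x'))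
        linarith
      · simp [hw, hx']
    · simp [hw, hx]
  have hsum : Real.exp (-2 * M) * (1 / 4 * Real.exp (-2 * M) * α ^ 2 * (∑ x, w x)) * (∑ x, w x) ≤
      2 * ((∑ x, w x) * (∑ x, w x * G x * q x) - (∑ x, w x * q x) * ∑ x, w x * G x) := by
    rw [two_mul_cov_eq, Finset.sum_comm, mul_comm, Finset.sum_mul]
    refine Finset.sum_le_sum fun x' _ => ?_
    have h1 := sum_sq_sub_ge hdiag hM0 hM (Finset.disjoint_right.1 hST hi) y hGi (G x')
    have h2 := mul_le_mul_of_nonneg_left h1 (mul_nonneg (Real.exp_pos (-2 * M)).le (hw0 x'))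
    calc _ = Real.exp (-2 * M) * w x' * (1 / 4 * Real.exp (-2 * M) * α ^ 2 * ∑ x, w x) := by ring
      _ ≤ _ := h2
      _ = ∑ x, Real.exp (-2 * M) * (w x * w x' * (G x - G x') ^ 2) := by
        rw [Finset.mul_sum]
        exact Finset.sum_congr rfl fun x _ => by ring
      _ ≤ _ := Finset.sum_le_sum fun x _ => hpair x x'
  rw [← hcov] at hsum
  nlinarith [hsum, hc]

theorem exists_cylInfluence_ge (hdiag : ∀ i, θ.coupling i i = 0) {M α β : ℝ} {d : ℕ} (hM0 : 0 ≤ M)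
    (hα : 0 ≤ α) (hβ : 0 < β) (hM : ∀ u x, |θ.localField u x| ≤ M) (hu : u ∉ S)
    {T : Finset (Fin p)} (huT : u ∉ T) (hT : ∀ j, j ∉ S → j ∉ T → θ.coupling u j = 0)
    (hST : Disjoint S T) (hne : T.Nonempty) (hcard : T.card ≤ d) (hd : 1 ≤ d)
    (hαT : ∀ j ∈ T, α ≤ |θ.coupling u j|) (hβT : ∀ j ∈ T, |θ.coupling u j| ≤ β) :
    ∃ i ∈ T, (1 / 2 * Real.exp (-2 * M)) ^ 2 * α ^ 2 / (d * β) ≤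
      cylInfluence θ.pmf.toMeasure.real u i S := by
  classical
  by_contra! hcon
  obtain ⟨i, hi⟩ := hne
  have hlow := Finset.sum_le_sum fun y (_ : y ∈ (Finset.univ : Finset (S → Bool))) =>
    sum_coupling_mul_covGap_ge hdiag hM0 hα hM hu huT hT hST hi (hαT i hi) y
  have htot : ∑ y : S → Bool, ∑ x, (cylinder S y).indicator θ.mass x = 1 := by
    rw [Finset.sum_comm]
    have : ∀ x, ∑ y, (cylinder S y).indicator θ.mass x = θ.mass x := by
      intro x
      rw [Finset.sum_eq_single (S.restrict x)]
      · exact Set.indicator_of_mem (by simp [cylinder]) _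
      · intro y _ hy
        exact Set.indicator_of_notMem (by simpa [cylinder] using hy.symm) _
      · simp
    simp only [this, Param.mass]
    rw [← Finset.sum_div]
    exact div_self θ.partition_pos.ne'
  rw [← Finset.mul_sum, htot, mul_one, Finset.sum_comm] at hlow
  have hd' : (0 : ℝ) < d := by exact_mod_cast hd
  have hterm : ∀ j ∈ T, ∑ y, θ.coupling u j * covGap θ.pmf.toMeasure.real u j (cylinder S y) ≤
      β / 2 * cylInfluence θ.pmf.toMeasure.real u j S := by
    intro j hj
    rw [cylInfluence, ← mul_assoc, div_mul_cancel₀ _ (two_ne_zero), Finset.mul_sum]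
    refine Finset.sum_le_sum fun y _ => (le_abs_self _).trans ?_
    rw [abs_mul]
    exact mul_le_mul_of_nonneg_right (hβT j hj) (abs_nonneg _)
  have hup : ∑ j ∈ T, β / 2 * cylInfluence θ.pmf.toMeasure.real u j S <
      ∑ j ∈ T, β / 2 * ((1 / 2 * Real.exp (-2 * M)) ^ 2 * α ^ 2 / (d * β)) :=
    Finset.sum_lt_sum_of_nonempty ⟨i, hi⟩ fun j hj =>
      mul_lt_mul_of_pos_left (hcon j hj) (by positivity)
  have hlast : ∑ j ∈ T, β / 2 * ((1 / 2 * Real.exp (-2 * M)) ^ 2 * α ^ 2 / (d * β)) ≤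
      1 / 8 * Real.exp (-2 * M) ^ 2 * α ^ 2 := by
    rw [Finset.sum_const, nsmul_eq_mul]
    calc (T.card : ℝ) * (β / 2 * ((1 / 2 * Real.exp (-2 * M)) ^ 2 * α ^ 2 / (d * β)))
        ≤ d * (β / 2 * ((1 / 2 * Real.exp (-2 * M)) ^ 2 * α ^ 2 / (d * β))) :=
          mul_le_mul_of_nonneg_right (by exact_mod_cast hcard) (by positivity)
      _ = 1 / 8 * Real.exp (-2 * M) ^ 2 * α ^ 2 := by field_simp; ring
  linarith [Finset.sum_le_sum hterm]

end

/-! ### The model on a graph of bounded degree -/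

theorem Param.Valid.coupling_self {p : ℕ} {G : SimpleGraph (Fin p)} {θ : Param p} {α β h : ℝ}
    (hθ : θ.Valid G α β h) (i : Fin p) : θ.coupling i i = 0 :=
  hθ.coupling_eq_zero i i (G.loopless.irrefl i)

section

variable {p d : ℕ} {G : SimpleGraph (Fin p)} [DecidableRel G.Adj] {θ : Param p} {α β h : ℝ}
  {u i : Fin p} {S : Finset (Fin p)}

theorem Param.Valid.abs_localField_le (hθ : θ.Valid G α β h) (hG : ∀ i, G.degree i ≤ d)
    (hβ : 0 ≤ β) (u : Fin p) (x : Config p) : |θ.localField u x| ≤ β * d + h := by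
  have hspin : ∀ b, |spin b| = 1 := fun b => by cases b <;> simp [spin]
  have h1 : |∑ j, θ.coupling u j * spin (x j)| ≤ β * d := by
    rw [← Finset.sum_subset (Finset.subset_univ (G.neighborFinset u))]
    · refine (Finset.abs_sum_le_sum_abs _ _).trans ?_
      refine (Finset.sum_le_sum fun j hj => (?_ : _ ≤ β)).trans ?_
      · rw [abs_mul, hspin, mul_one]
        exact hθ.coupling_le u j (by simpa using hj)
      · rw [Finset.sum_const, G.card_neighborFinset_eq_degree, nsmul_eq_mul, mul_comm]
        exact mul_le_mul_of_nonneg_left (by exact_mod_cast hG u) hβ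
    · intro j _ hj
      rw [hθ.coupling_eq_zero u j (by simpa using hj), zero_mul]
  exact (abs_add_le _ _).trans (add_le_add h1 (hθ.field_le u))

theorem Param.Valid.cylInfluence_eq_zero (hθ : θ.Valid G α β h) (hu : u ∉ S) (hiu : i ≠ u)
    (hN : G.neighborFinset u ⊆ S) : cylInfluence θ.pmf.toMeasure.real u i S = 0 :=
  IsingLearn.cylInfluence_eq_zero hθ.coupling_self hu hiu fun j hj =>
    hθ.coupling_eq_zero u j fun hadj => hj (hN (by simpa using hadj))

theorem Param.Valid.exists_cylInfluence_ge (hθ : θ.Valid G α β h) (hG : ∀ i, G.degree i ≤ d)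
    (hd : 1 ≤ d) (hα : 0 < α) (hαβ : α ≤ β) (hh : 0 ≤ h) (hu : u ∉ S)
    (hN : ¬ G.neighborFinset u ⊆ S) :
    ∃ i ∈ G.neighborFinset u \ S, delta d β h ^ 2 * α ^ 2 / (d * β) ≤
      cylInfluence θ.pmf.toMeasure.real u i S := by
  have hβ : 0 < β := hα.trans_le hαβ
  exact IsingLearn.exists_cylInfluence_ge hθ.coupling_self
    (M := β * d + h) (by positivity) hα.le hβ (hθ.abs_localField_le hG hβ.le) hu (by simp)
    (fun j hjS hjT => hθ.coupling_eq_zero u j fun hadj => hjT (by simp [hadj, hjS]))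
    Finset.disjoint_sdiff (Finset.sdiff_nonempty.2 hN)
    ((Finset.card_le_card Finset.sdiff_subset).trans (hG u)) hd
    (fun j hj => hθ.coupling_ge u j (by simpa using (Finset.mem_sdiff.1 hj).1))
    (fun j hj => hθ.coupling_le u j (by simpa using (Finset.mem_sdiff.1 hj).1))

end

/-! ### The constants -/

section

variable {d : ℕ} {α β h : ℝ}

theorem delta_pos : 0 < delta d β h := by unfold delta; positivity

theorem delta_le_half (hβ : 0 ≤ β) (hh : 0 ≤ h) : delta d β h ≤ 1 / 2 := by
  have : Real.exp (-2 * (β * d + h)) ≤ 1 := by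
    rw [Real.exp_le_one_iff]
    have : 0 ≤ β * d + h := by positivity
    linarith
  unfold delta
  linarith

theorem tauStar_pos (hd : 1 ≤ d) (hα : 0 < α) (hβ : 0 < β) : 0 < tauStar d α β h := by
  have : (0 : ℝ) < d := by exact_mod_cast hd
  have := delta_pos (d := d) (β := β) (h := h)
  unfold tauStar
  positivity

theorem two_mul_tauStar_le (hd : 1 ≤ d) (hβ : 0 < β) (hh : 0 ≤ h) :
    2 * tauStar d α β h ≤ delta d β h ^ 2 * α ^ 2 / (d * β) := by
  have hd' : (0 : ℝ) < d := by exact_mod_cast hd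
  have h1 : delta d β h ^ (4 * d + 1) ≤ delta d β h ^ 2 :=
    pow_le_pow_of_le_one delta_pos.le ((delta_le_half hβ.le hh).trans (by norm_num)) (by omega)
  have h2 : 2 * tauStar d α β h = α ^ 2 * delta d β h ^ (4 * d + 1) / (d * β) / 8 := by
    unfold tauStar
    field_simp
    ring
  have h3 : α ^ 2 * delta d β h ^ (4 * d + 1) / (d * β) ≤ delta d β h ^ 2 * α ^ 2 / (d * β) := by
    rw [mul_comm (delta d β h ^ 2)]
    gcongr
  have h4 : 0 ≤ delta d β h ^ 2 * α ^ 2 / (d * β) := by positivity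
  rw [h2]
  linarith

theorem tauStar_le_one (hd : 1 ≤ d) (hα : 0 < α) (hαβ : α ≤ β) (hh : 0 ≤ h) :
    tauStar d α β h ≤ 1 := by
  have hβ : 0 < β := hα.trans_le hαβ
  have hd' : (1 : ℝ) ≤ d := by exact_mod_cast hd
  have h1 : delta d β h ^ (4 * d + 1) ≤ delta d β h :=
    pow_le_of_le_one delta_pos.le ((delta_le_half hβ.le hh).trans (by norm_num)) (by omega)
  have h2 : delta d β h * β ≤ 1 := by
    have h3 : Real.exp (-2 * (β * d + h)) ≤ Real.exp (-β) := Real.exp_le_exp.2 (by nlinarith)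
    have h4 : Real.exp (-β) * β ≤ 1 := by
      rw [Real.exp_neg, inv_mul_le_iff₀ (Real.exp_pos β)]
      linarith [Real.add_one_le_exp β]
    unfold delta
    nlinarith
  have h3 : α ^ 2 ≤ β ^ 2 := pow_le_pow_left₀ hα.le hαβ 2
  unfold tauStar
  rw [div_le_one (by positivity)]
  calc α ^ 2 * delta d β h ^ (4 * d + 1) ≤ β ^ 2 * delta d β h :=
        mul_le_mul h3 h1 (pow_nonneg delta_pos.le _) (by positivity)
    _ = β * (delta d β h * β) := by ring
    _ ≤ β * 1 := mul_le_mul_of_nonneg_left h2 hβ.le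
    _ ≤ 16 * d * β := by nlinarith

theorem one_le_one_div_tauStar_sq (hd : 1 ≤ d) (hα : 0 < α) (hαβ : α ≤ β) (hh : 0 ≤ h) :
    1 ≤ 1 / tauStar d α β h ^ 2 := by
  have hτ := tauStar_pos (h := h) hd hα (hα.trans_le hαβ)
  rw [le_div_iff₀ (by positivity), one_mul]
  exact pow_le_one₀ hτ.le (tauStar_le_one hd hα hαβ hh)

theorem ellStar_eq : ellStar d α β h = 8 * (1 / tauStar d α β h ^ 2) := by
  rw [ellStar, mul_one_div]

theorem ellStar_ge (hd : 1 ≤ d) (hα : 0 < α) (hαβ : α ≤ β) (hh : 0 ≤ h) :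
    8 ≤ ellStar d α β h := by
  have := one_le_one_div_tauStar_sq hd hα hαβ hh
  rw [ellStar_eq]
  linarith

theorem sampleCoeff_pos (hd : 1 ≤ d) (hα : 0 < α) (hαβ : α ≤ β) (hh : 0 ≤ h) :
    0 < sampleCoeff d α β h := by
  have h1 := ellStar_ge hd hα hαβ hh
  have h2 := tauStar_pos (h := h) hd hα (hα.trans_le hαβ)
  have h3 := delta_pos (d := d) (β := β) (h := h)
  unfold sampleCoeff epsStar
  positivity

theorem one_div_tauStar_le (hd : 1 ≤ d) (hα : 0 < α) (hβ : 0 < β) (hh : 0 ≤ h) :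
    1 / tauStar d α β h ≤ 16 * Real.exp (11 * (d * (β * d + h + 1))) / α ^ 2 := by
  have hd' : (1 : ℝ) ≤ d := by exact_mod_cast hd
  set m := β * d + h with hm
  have hm0 : 0 ≤ m := by positivity
  have hδ : Real.exp (-(2 * m + 1)) ≤ delta d β h := by
    rw [delta, neg_add, Real.exp_add, mul_comm, ← neg_mul]
    refine mul_le_mul_of_nonneg_right ?_ (Real.exp_pos _).le
    rw [Real.exp_neg, one_div]
    exact inv_anti₀ (by norm_num) (by linarith [Real.add_one_le_exp (1 : ℝ)])
  have hpow : Real.exp (-(10 * (d * (m + 1)))) ≤ delta d β h ^ (4 * d + 1) := by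
    refine le_trans ?_ (pow_le_pow_left₀ (Real.exp_pos _).le hδ _)
    rw [← Real.exp_nat_mul]
    refine Real.exp_le_exp.2 ?_
    push_cast
    nlinarith [mul_nonneg hm0 (by linarith : (0 : ℝ) ≤ d - 1)]
  have hdβ : d * β ≤ Real.exp (d * (m + 1)) := by
    have h1 : d * β ≤ d * (m + 1) := by
      refine mul_le_mul_of_nonneg_left ?_ (by linarith)
      nlinarith
    linarith [Real.add_one_le_exp (d * (m + 1) : ℝ)]
  have hτ : 1 / tauStar d α β h = 16 * (d * β) / (α ^ 2 * delta d β h ^ (4 * d + 1)) := by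
    rw [tauStar, one_div_div]; ring
  rw [hτ, div_le_div_iff₀ (mul_pos (by positivity) (pow_pos delta_pos _)) (by positivity)]
  have h1 : d * β ≤ Real.exp (11 * (d * (m + 1))) * delta d β h ^ (4 * d + 1) := by
    refine hdβ.trans ?_
    calc Real.exp (d * (m + 1)) = Real.exp (11 * (d * (m + 1))) * Real.exp (-(10 * (d * (m + 1)))) := by
          rw [← Real.exp_add]; ring_nf
      _ ≤ _ := mul_le_mul_of_nonneg_left hpow (Real.exp_pos _).le
  nlinarith [mul_le_mul_of_nonneg_left h1 (by positivity : 0 ≤ 16 * α ^ 2)]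

theorem sampleCoeff_le (hd : 1 ≤ d) (hα : 0 < α) (hαβ : α ≤ β) (hh : 0 ≤ h) :
    sampleCoeff d α β h ≤
      Real.exp (1630720 * α ^ (-4 : ℝ) * Real.exp (23 * d * (β * d + h + 1))) := by
  have hβ : 0 < β := hα.trans_le hαβ
  have hd' : (1 : ℝ) ≤ d := by exact_mod_cast hd
  have hm0 : 0 ≤ β * d + h := by positivity
  have hτ := tauStar_pos (h := h) hd hα hβ
  have hδ := delta_pos (d := d) (β := β) (h := h)
  set B : ℝ := d * (β * d + h + 1) with hB
  have hB1 : 1 ≤ B := by nlinarith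
  set Q := 1 / tauStar d α β h ^ 2 with hQ
  have hQ1 : 1 ≤ Q := one_le_one_div_tauStar_sq hd hα hαβ hh
  have hQle : Q ≤ 256 * α ^ (-4 : ℝ) * Real.exp (22 * B) := by
    have h1 := pow_le_pow_left₀ (by positivity) (one_div_tauStar_le hd hα hβ hh) 2
    rw [div_pow, one_pow] at h1
    refine h1.trans_eq ?_
    rw [Real.rpow_neg hα.le, show (4 : ℝ) = ((4 : ℕ) : ℝ) by norm_num, Real.rpow_natCast,
      div_pow, mul_pow, ← Real.exp_nat_mul]
    push_cast
    field_simp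
    norm_num
    rw [hB]
    ring
  have hell : ellStar d α β h = 8 * Q := ellStar_eq
  have hdel : 1 / delta d β h ^ (2 * ellStar d α β h) ≤ Real.exp (32 * Q * B) := by
    rw [one_div, ← Real.rpow_neg hδ.le, Real.rpow_def_of_pos hδ, Real.exp_le_exp, delta,
      Real.log_mul (by norm_num) (Real.exp_pos _).ne', Real.log_exp, one_div, Real.log_inv, hell]
    have h2 : Real.log 2 ≤ 1 := by linarith [Real.log_le_sub_one_of_pos (two_pos)]
    have h3 : Real.log 2 + 2 * (β * d + h) ≤ 2 * B := by nlinarith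
    nlinarith [mul_le_mul_of_nonneg_left h3 (by linarith : 0 ≤ 16 * Q)]
  have hco : sampleCoeff d α β h =
      576 * (8 * Q + 3) * Q * (1 / delta d β h ^ (2 * ellStar d α β h)) := by
    rw [sampleCoeff, epsStar, hell, hQ]
    have := Real.rpow_pos_of_pos hδ (2 * (8 * (1 / tauStar d α β h ^ 2)))
    field_simp
    norm_num
  have hQQ : 576 * (8 * Q + 3) * Q ≤ Real.exp (6338 * Q) := by
    have h1 : 576 * (8 * Q + 3) * Q ≤ 6336 * (Q * Q) := by nlinarith
    have h2 : Q ≤ Real.exp Q := by linarith [Real.add_one_le_exp Q]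
    have h3 : (6336 : ℝ) ≤ Real.exp (6336 * Q) := by
      linarith [Real.add_one_le_exp (6336 * Q)]
    have h4 : Real.exp (6338 * Q) = Real.exp (6336 * Q) * (Real.exp Q * Real.exp Q) := by
      rw [← Real.exp_add, ← Real.exp_add]; ring_nf
    rw [h4]
    exact h1.trans (mul_le_mul h3 (mul_le_mul h2 h2 (by linarith) (Real.exp_pos _).le)
      (by nlinarith) (Real.exp_pos _).le)
  rw [hco]
  have hpos : 0 ≤ 1 / delta d β h ^ (2 * ellStar d α β h) :=
    one_div_nonneg.2 (Real.rpow_nonneg hδ.le _)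
  refine (mul_le_mul hQQ hdel hpos (Real.exp_pos _).le).trans ?_
  rw [← Real.exp_add, Real.exp_le_exp]
  have hBe : B ≤ Real.exp B := by linarith [Real.add_one_le_exp B]
  have h23 : Real.exp (23 * d * (β * d + h + 1)) = Real.exp (22 * B) * Real.exp B := by
    rw [← Real.exp_add, hB]; ring_nf
  rw [h23]
  have h1 : 6338 * Q + 32 * Q * B ≤ 6370 * (Q * Real.exp B) := by nlinarith
  have h2 := mul_le_mul_of_nonneg_right hQle (Real.exp_pos B).le
  linarith

end

/-! ### Correctness -/

section

variable {p n d : ℕ} {G : SimpleGraph (Fin p)} [DecidableRel G.Adj] {θ : Param p}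
  {α β h ζ τ : ℝ} {X : Samples p n} {u : Fin p} {S : Finset (Fin p)}

/-- The pruning loop removes exactly the nodes outside of the neighborhood. -/
theorem foldl_pruneStep {N : Finset (Fin p)}
    (hin : ∀ T ⊆ S, ∀ i ∈ N, i ∈ S → N ⊆ T → τ ≤ empInfluence X u i (T.erase i))
    (hout : ∀ T ⊆ S, ∀ i ∉ N, i ∈ S → N ⊆ T → empInfluence X u i (T.erase i) < τ)
    (l : List (Fin p)) (hl : ∀ i ∈ l, i ∈ S) (T : Finset (Fin p)) (hTS : T ⊆ S) (hNT : N ⊆ T) :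
    N ⊆ l.foldl (pruneStep X τ u) T ∧ l.foldl (pruneStep X τ u) T ⊆ T ∧
      ∀ i ∈ l, i ∉ N → i ∉ l.foldl (pruneStep X τ u) T := by
  induction l generalizing T with
  | nil => simp [hNT]
  | cons i l ih =>
    have hi : i ∈ S := hl i (by simp)
    have hl' : ∀ j ∈ l, j ∈ S := fun j hj => hl j (by simp [hj])
    rw [List.foldl_cons]
    by_cases hiN : i ∈ N
    · have hstep : pruneStep X τ u T i = T := if_neg (not_lt.2 (hin T hTS i hiN hi hNT))
      rw [hstep]
      obtain ⟨h1, h2, h3⟩ := ih hl' T hTS hNT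
      refine ⟨h1, h2, fun j hj hjN => ?_⟩
      rcases List.mem_cons.1 hj with rfl | hj
      · exact absurd hiN hjN
      · exact h3 j hj hjN
    · have hstep : pruneStep X τ u T i = T.erase i := if_pos (hout T hTS i hiN hi hNT)
      rw [hstep]
      obtain ⟨h1, h2, h3⟩ := ih hl' (T.erase i) ((Finset.erase_subset _ _).trans hTS)
        fun j hj => Finset.mem_erase.2 ⟨fun e => hiN (e ▸ hj), hNT hj⟩
      refine ⟨h1, h2.trans (Finset.erase_subset _ _), fun j hj hjN => ?_⟩
      rcases List.mem_cons.1 hj with rfl | hj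
      · exact fun hmem => Finset.notMem_erase j T (h2 hmem)
      · exact h3 j hj hjN

theorem LearnNbhd.eq_neighborFinset (hG : ∀ i, G.degree i ≤ d) (hθ : θ.Valid G α β h)
    (hd : 1 ≤ d) (hα : 0 < α) (hαβ : α ≤ β) (hh : 0 ≤ h)
    (hclose : ∀ (u i : Fin p) (S : Finset (Fin p)), (S.card : ℝ) ≤ ellStar d α β h →
      i ∉ insert u S →
      |empInfluence X u i S - cylInfluence θ.pmf.toMeasure.real u i S| ≤ epsStar d α β h)
    {R : Finset (Fin p)} (hR : LearnNbhd X (tauStar d α β h) u R) : R = G.neighborFinset u := by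
  have hτ := tauStar_pos (h := h) hd hα (hα.trans_le hαβ)
  set τ := tauStar d α β h with hτdef
  have hε : epsStar d α β h = τ / 2 := rfl
  rw [hε] at hclose
  obtain ⟨S, l, ⟨hS, hlt⟩, -, hl, rfl⟩ := hR
  have huS := hS.self_notMem hτ
  have hcard : (S.card : ℝ) ≤ ellStar d α β h := by
    have h1 := hS.card_le hτ
    have h2 := one_le_one_div_tauStar_sq (h := h) hd hα hαβ hh
    rw [ellStar_eq]
    linarith
  have hcardT : ∀ T ⊆ S, (T.card : ℝ) ≤ ellStar d α β h := fun T hT =>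
    le_trans (by exact_mod_cast Finset.card_le_card hT) hcard
  have hlarge : ∀ T ⊆ S, ¬ G.neighborFinset u ⊆ T →
      ∃ i ∈ G.neighborFinset u \ T, τ ≤ empInfluence X u i T := by
    intro T hT hN
    obtain ⟨i, hi, hle⟩ := hθ.exists_cylInfluence_ge hG hd hα hαβ hh (fun h => huS (hT h)) hN
    refine ⟨i, hi, ?_⟩
    have h1 := two_mul_tauStar_le (α := α) hd (hα.trans_le hαβ) hh
    have hiu : i ≠ u := by rintro rfl; simp at hi
    have h2 := abs_le.1 (hclose u i T (hcardT T hT) (by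
      simp only [Finset.mem_insert, not_or]
      exact ⟨hiu, (Finset.mem_sdiff.1 hi).2⟩))
    linarith [h2.1]
  have hNS : G.neighborFinset u ⊆ S := by
    by_contra hN
    obtain ⟨i, -, hi⟩ := hlarge S subset_rfl hN
    exact absurd (hlt i) (not_lt.2 hi)
  obtain ⟨h1, h2, h3⟩ := foldl_pruneStep (X := X) (τ := τ) (u := u) (S := S)
    (N := G.neighborFinset u)
    (fun T hT i hiN hi hNT => by
      obtain ⟨j, hj, hle⟩ := hlarge (T.erase i) ((Finset.erase_subset _ _).trans hT)
        fun hc => Finset.notMem_erase i T (hc hiN)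
      obtain ⟨hjN, hjT⟩ := Finset.mem_sdiff.1 hj
      have : j = i := by
        by_contra hne
        exact hjT (Finset.mem_erase.2 ⟨hne, hNT hjN⟩)
      rwa [← this] at hle ⊢)
    (fun T hT i hiN hi hNT => by
      have hiu : i ≠ u := by rintro rfl; exact huS hi
      have hTS := (Finset.erase_subset i T).trans hT
      have h0 := hθ.cylInfluence_eq_zero (S := T.erase i) (fun h => huS (hTS h)) hiu
        fun j hj => Finset.mem_erase.2 ⟨fun e => hiN (e ▸ hj), hNT hj⟩
      have h2 := abs_le.1 (hclose u i (T.erase i) (hcardT _ hTS) (by simp [hiu]))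
      rw [h0] at h2
      linarith [h2.2])
    l (fun i hi => by rw [← hl]; simpa using hi) S subset_rfl hNS
  refine Finset.Subset.antisymm (fun j hj => ?_) h1
  by_contra hjN
  exact h3 j (by have := h2 hj; rw [← hl] at this; simpa using this) hjN hj

theorem abs_empInfluence_sub_le {k : ℕ} (hX : X ∈ goodSamples θ.pmf.toMeasure n (k + 2)
      (τ / (16 * 2 ^ k))) (hτ : 0 ≤ τ) {i : Fin p} (hS : S.card ≤ k) (hi : i ∉ insert u S) :
    |empInfluence X u i S - cylInfluence θ.pmf.toMeasure.real u i S| ≤ τ / 2 := by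
  rw [empInfluence_eq_cylInfluence hi]
  refine (abs_cylInfluence_sub_le empProb_nonneg (fun _ _ => empProb_mono)
    (fun _ => measureReal_nonneg) (fun _ _ hAB => measureReal_mono hAB)
    (fun L hL => (hX L hL).le) (Nat.add_le_add_right hS 2)).trans ?_
  have h2 : (2 : ℝ) ^ S.card ≤ 2 ^ k := pow_le_pow_right₀ (by norm_num) hS
  calc 8 * 2 ^ S.card * (τ / (16 * 2 ^ k)) ≤ 8 * 2 ^ k * (τ / (16 * 2 ^ k)) := by gcongr
    _ = τ / 2 := by field_simp; ring

theorem card_mul_exp_le (hp : 2 ≤ p) (hζ : 0 < ζ) (hζ1 : ζ < 1) {k : ℕ} {x : ℝ}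
    (hx : (3 * k + 1) * Real.log (p / ζ) ≤ x) :
    (2 * p + 1) ^ k * (2 * Real.exp (-x)) ≤ ζ := by
  have hp' : (2 : ℝ) ≤ p := by exact_mod_cast hp
  have hp0 : (0 : ℝ) < p := by linarith
  have h1 : (2 * (p : ℝ) + 1) ^ k ≤ p ^ (3 * k) := by
    rw [pow_mul]
    refine pow_le_pow_left₀ (by positivity) ?_ k
    nlinarith [sq_nonneg ((p : ℝ) - 2), mul_nonneg (sq_nonneg (p : ℝ)) (by linarith : (0:ℝ) ≤ p - 2)]
  have h2 : Real.exp (-x) ≤ (ζ / p) ^ (3 * k + 1) := by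
    have h3 : (ζ / p) ^ (3 * k + 1) = Real.exp (-((3 * k + 1) * Real.log (p / ζ))) := by
      rw [← inv_div, inv_pow, Real.exp_neg]
      congr 1
      rw [← Real.exp_log (pow_pos (div_pos hp0 hζ) (3 * k + 1)), Real.log_pow]
      push_cast
      rfl
    rw [h3]
    exact Real.exp_le_exp.2 (by linarith)
  calc (2 * (p : ℝ) + 1) ^ k * (2 * Real.exp (-x))
      ≤ p ^ (3 * k) * (p * (ζ / p) ^ (3 * k + 1)) := by gcongr
    _ = ζ ^ (3 * k + 1) := by rw [div_pow]; field_simp; ring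
    _ ≤ ζ := pow_le_of_le_one hζ.le hζ1.le (by omega)

theorem sampleSize_ge (hd : 1 ≤ d) (hα : 0 < α) (hαβ : α ≤ β) (hh : 0 ≤ h) {L : ℝ} (hL : 0 ≤ L)
    (hn : sampleCoeff d α β h * L ≤ n) :
    (3 * ((⌊ellStar d α β h⌋₊ + 2 : ℕ) : ℝ) + 1) * L ≤
      2 * n * (tauStar d α β h / (16 * 2 ^ ⌊ellStar d α β h⌋₊)) ^ 2 := by
  have hβ : 0 < β := hα.trans_le hαβ
  have hell := ellStar_ge hd hα hαβ hh
  have hτ := tauStar_pos (h := h) hd hα hβ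
  have hδ := delta_pos (d := d) (β := β) (h := h)
  set ℓ := ellStar d α β h with hℓ
  set k := ⌊ℓ⌋₊ with hk
  have hkℓ : (k : ℝ) ≤ ℓ := Nat.floor_le (by linarith)
  have hpow : delta d β h ^ (2 * ℓ) * (2 ^ k) ^ 2 ≤ 1 := by
    have h1 : delta d β h ^ (2 * ℓ) ≤ (1 / 2 : ℝ) ^ (2 * ℓ) :=
      Real.rpow_le_rpow hδ.le (delta_le_half hβ.le hh) (by linarith)
    have h2 : (1 / 2 : ℝ) ^ (2 * ℓ) ≤ (1 / 2 : ℝ) ^ ((2 * k : ℕ) : ℝ) :=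
      Real.rpow_le_rpow_of_exponent_ge (by norm_num) (by norm_num) (by push_cast; linarith)
    rw [Real.rpow_natCast] at h2
    calc delta d β h ^ (2 * ℓ) * (2 ^ k) ^ 2 ≤ (1 / 2 : ℝ) ^ (2 * k) * (2 ^ k) ^ 2 := by
          gcongr
          exact h1.trans h2
      _ = 1 := by rw [← pow_mul, mul_comm k 2, ← mul_pow]; norm_num
  have hδpos := Real.rpow_pos_of_pos hδ (2 * ℓ)
  have hcoef : 9 / 2 * (ℓ + 3) ≤ 2 * sampleCoeff d α β h * (tauStar d α β h / (16 * 2 ^ k)) ^ 2 := by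
    have e : 2 * sampleCoeff d α β h * (tauStar d α β h / (16 * 2 ^ k)) ^ 2 =
        9 / 2 * (ℓ + 3) / (delta d β h ^ (2 * ℓ) * (2 ^ k) ^ 2) := by
      rw [sampleCoeff, epsStar, ← hℓ]
      field_simp
      norm_num
    rw [e, le_div_iff₀ (by positivity)]
    exact mul_le_of_le_one_right (by linarith) hpow
  have h1 : (3 * ((k + 2 : ℕ) : ℝ) + 1) * L ≤ 9 / 2 * (ℓ + 3) * L := by
    refine mul_le_mul_of_nonneg_right ?_ hL
    push_cast
    linarith
  have h2 := mul_le_mul_of_nonneg_right hcoef hL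
  have h3 := mul_le_mul_of_nonneg_right hn
    (by positivity : 0 ≤ 2 * (tauStar d α β h / (16 * 2 ^ k)) ^ 2)
  linarith

instance (θ : Param p) (n : ℕ) : IsProbabilityMeasure (θ.sampleLaw n) :=
  inferInstanceAs (IsProbabilityMeasure (Measure.pi fun _ : Fin n => θ.pmf.toMeasure))

theorem prob_correct (hG : ∀ i, G.degree i ≤ d) (hθ : θ.Valid G α β h)
    (hd : 1 ≤ d) (hα : 0 < α) (hαβ : α ≤ β) (hh : 0 ≤ h) (hζ : 0 < ζ)
    (hn : sampleBound d α β h ζ p ≤ n) :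
    1 - ζ ≤ (θ.sampleLaw n).real {X | ∀ u R, LearnNbhd X (tauStar d α β h) u R →
      R = G.neighborFinset u} := by
  rcases le_or_gt 1 ζ with hζ1 | hζ1
  · exact (sub_nonpos.2 hζ1).trans measureReal_nonneg
  have hτ := tauStar_pos (h := h) hd hα (hα.trans_le hαβ)
  have hℓ := ellStar_ge hd hα hαβ hh
  rcases lt_or_ge p 2 with hp | hp
  · have : {X : Samples p n | ∀ u R, LearnNbhd X (tauStar d α β h) u R →
        R = G.neighborFinset u} = Set.univ := by
      refine Set.eq_univ_of_forall fun X u R hR => hR.eq_neighborFinset hG hθ hd hα hαβ hh ?_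
      intro u i S _ hi
      have : i = u := Fin.ext (by omega)
      simp [this] at hi
    rw [this, probReal_univ]
    linarith
  have hp' : (2 : ℝ) ≤ p := by exact_mod_cast hp
  have hlog : 0 < Real.log (p / ζ) := Real.log_pos (by rw [lt_div_iff₀ hζ]; linarith)
  have hn0 : 0 < n := by
    have : (0 : ℝ) < n := (mul_pos (sampleCoeff_pos hd hα hαβ hh) hlog).trans_le hn
    exact_mod_cast this
  have hgood := measure_goodSamples θ.pmf.toMeasure (n := n) (⌊ellStar d α β h⌋₊ + 2)
    (γ := tauStar d α β h / (16 * 2 ^ ⌊ellStar d α β h⌋₊)) (by positivity) hn0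
  have hfail := card_mul_exp_le hp hζ hζ1 (sampleSize_ge hd hα hαβ hh hlog.le hn)
  refine le_trans (by linarith) (hgood.trans (measureReal_mono fun X hX u R hR => ?_))
  refine hR.eq_neighborFinset hG hθ hd hα hαβ hh fun u i S hS hi => ?_
  exact abs_empInfluence_sub_le hX hτ.le (Nat.le_floor hS) hi

open Classical in
/-- The running time of the program. -/
noncomputable def learnTime (p n : ℕ) (X : Samples p n) (τ : ℝ) (u : Fin p) : ℕ :=
  if hτ : 0 < τ then (learnProg_spec X u hτ).choose else 0

theorem learnTime_spec (X : Samples p n) (u : Fin p) (hτ : 0 < τ) :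
    ∃ S R, PseudoNbhd X τ u S ∧ LearnNbhd X τ u R ∧
      Returns learnProg X τ u (learnTime p n X τ u) R ∧
      learnTime p n X τ u ≤ 200 * ((S.card + 1) * (p + 1) * (n + 1)) := by
  rw [learnTime, dif_pos hτ]
  exact (learnProg_spec X u hτ).choose_spec

theorem learnTime_le (hd : 1 ≤ d) (hα : 0 < α) (hαβ : α ≤ β) (hh : 0 ≤ h) (hn : 1 ≤ n)
    (X : Samples p n) (u : Fin p) :
    (learnTime p n X (tauStar d α β h) u : ℝ) ≤ 800 * ellStar d α β h * p * n := by
  have hτ := tauStar_pos (h := h) hd hα (hα.trans_le hαβ)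
  obtain ⟨S, R, hS, -, -, ht⟩ := learnTime_spec X u hτ
  have hcard := hS.1.card_le hτ
  have h1 := one_le_one_div_tauStar_sq (h := h) hd hα hαβ hh
  have hp : (1 : ℝ) ≤ p := by exact_mod_cast Fin.pos u
  have hn' : (1 : ℝ) ≤ n := by exact_mod_cast hn
  have h2 : (S.card : ℝ) + 1 ≤ ellStar d α β h := by rw [ellStar_eq]; linarith
  have h3 := ellStar_ge (h := h) hd hα hαβ hh
  calc (learnTime p n X (tauStar d α β h) u : ℝ)
      ≤ 200 * ((S.card + 1) * (p + 1) * (n + 1)) := by exact_mod_cast ht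
    _ ≤ 200 * (ellStar d α β h * (2 * p) * (2 * n)) := by gcongr <;> linarith
    _ = 800 * ellStar d α β h * p * n := by ring

theorem one_le_of_sampleBound_le (hd : 1 ≤ d) (hα : 0 < α) (hαβ : α ≤ β) (hh : 0 ≤ h)
    (hζ : 0 < ζ) (hζ1 : ζ < 1) (hp : 1 ≤ p) (hn : sampleBound d α β h ζ p ≤ n) : 1 ≤ n := by
  have hp' : (1 : ℝ) ≤ p := by exact_mod_cast hp
  have hlog : 0 < Real.log (p / ζ) := Real.log_pos (by rw [lt_div_iff₀ hζ]; linarith)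
  have : (0 : ℝ) < n := (mul_pos (sampleCoeff_pos hd hα hαβ hh) hlog).trans_le hn
  exact_mod_cast this

theorem ceil_sampleBound_le (hd : 1 ≤ d) (hα : 0 < α) (hαβ : α ≤ β) (hh : 0 ≤ h)
    (hζ : 0 < ζ) (hζ1 : ζ < 1) (hp : 2 ≤ p) :
    (⌈sampleBound d α β h ζ p⌉₊ : ℝ) ≤
      (sampleCoeff d α β h * (1 + 2 * Real.log (1 / ζ)) + 2) * Real.log p := by
  have hp' : (2 : ℝ) ≤ p := by exact_mod_cast hp
  have hc := sampleCoeff_pos hd hα hαβ hh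
  have hlogζ : 0 ≤ Real.log (1 / ζ) := Real.log_nonneg (by rw [le_div_iff₀ hζ]; linarith)
  have hlogp : 1 ≤ 2 * Real.log p := by
    have h1 : Real.log 2 ≤ Real.log p := Real.log_le_log two_pos hp'
    have h2 := Real.log_two_gt_d9
    linarith
  have hlog : Real.log (p / ζ) = Real.log p + Real.log (1 / ζ) := by
    rw [← Real.log_mul (by linarith) (by positivity), mul_one_div]
  have hle : Real.log (p / ζ) ≤ (1 + 2 * Real.log (1 / ζ)) * Real.log p := by
    rw [hlog]; nlinarith
  have h0 : 0 ≤ sampleBound d α β h ζ p :=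
    mul_nonneg hc.le (by rw [hlog]; linarith)
  have h1 := (Nat.ceil_lt_add_one h0).le
  have h2 := mul_le_mul_of_nonneg_left hle hc.le
  rw [sampleBound] at h1 ⊢
  linarith

end

end IsingLearn

open IsingLearn
theorem theorem1 :
    ∃ (prog : Prog) (T : (p n : ℕ) → Samples p n → ℝ → Fin p → ℕ),
      -- the program implements the algorithm, and `T` is its running time
      (∀ (p n : ℕ) (X : Samples p n) (τ : ℝ) (u : Fin p), 0 < τ →
        ∃ R : Finset (Fin p), LearnNbhd X τ u R ∧ Returns prog X τ u (T p n X τ u) R) ∧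
      ∃ C c c' c'' : ℝ, 0 < C ∧ 0 < c ∧ 0 < c' ∧ 0 < c'' ∧
        ∀ (d : ℕ) (α β h ζ : ℝ), 1 ≤ d → 0 < α → α ≤ β → 0 ≤ h → 0 < ζ →
          -- the order of the number of samples
          sampleCoeff d α β h ≤
            Real.exp (c * α ^ (-c') * Real.exp (c'' * d * (β * d + h + 1))) ∧
          -- correctness and running time
          (∀ (p n : ℕ) (G : SimpleGraph (Fin p)) [DecidableRel G.Adj] (θ : Param p),
            (∀ i, G.degree i ≤ d) → θ.Valid G α β h → sampleBound d α β h ζ p ≤ n →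
            1 - ζ ≤ (θ.sampleLaw n).real {X | ∀ u : Fin p,
              (∀ R, LearnNbhd X (tauStar d α β h) u R → R = G.neighborFinset u) ∧
              (T p n X (tauStar d α β h) u : ℝ) ≤ C * ellStar d α β h * p * n}) ∧
          -- with the smallest admissible number of samples, the running time is of order
          -- `p log p` for each node and `p² log p` in total
          ∃ K : ℝ, ∀ (p n : ℕ) (G : SimpleGraph (Fin p)) [DecidableRel G.Adj] (θ : Param p),
            (∀ i, G.degree i ≤ d) → θ.Valid G α β h → 2 ≤ p → n = ⌈sampleBound d α β h ζ p⌉₊ →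
            1 - ζ ≤ (θ.sampleLaw n).real {X |
              (∀ u : Fin p,
                (∀ R, LearnNbhd X (tauStar d α β h) u R → R = G.neighborFinset u) ∧
                (T p n X (tauStar d α β h) u : ℝ) ≤ K * (p * Real.log p)) ∧
              ∑ u : Fin p, (T p n X (tauStar d α β h) u : ℝ) ≤ K * (p ^ 2 * Real.log p)} := by
  refine ⟨learnProg, learnTime, fun p n X τ u hτ => ?_, 800, 1630720, 4, 23, by norm_num,
    by norm_num, by norm_num, by norm_num, fun d α β h ζ hd hα hαβ hh hζ => ⟨?_, ?_, ?_⟩⟩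
  · obtain ⟨S, R, -, hR, hret, -⟩ := learnTime_spec X u hτ
    exact ⟨R, hR, hret⟩
  · exact sampleCoeff_le hd hα hαβ hh
  · intro p n G _ θ hG hθ hn
    rcases le_or_gt 1 ζ with hζ1 | hζ1
    · exact (sub_nonpos.2 hζ1).trans measureReal_nonneg
    refine (prob_correct hG hθ hd hα hαβ hh hζ hn).trans (measureReal_mono fun X hX u => ?_)
    exact ⟨hX u, learnTime_le hd hα hαβ hh
      (one_le_of_sampleBound_le hd hα hαβ hh hζ hζ1 (Fin.pos u) hn) X u⟩
  · rcases le_or_gt 1 ζ with hζ1 | hζ1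
    · exact ⟨0, fun _ _ _ _ _ _ _ _ _ => (sub_nonpos.2 hζ1).trans measureReal_nonneg⟩
    refine ⟨800 * ellStar d α β h * (sampleCoeff d α β h * (1 + 2 * Real.log (1 / ζ)) + 2), ?_⟩
    intro p n G _ θ hG hθ hp hn
    have hbound : sampleBound d α β h ζ p ≤ n := hn ▸ Nat.le_ceil _
    have hℓ := ellStar_ge hd hα hαβ hh
    have htime : ∀ (X : Samples p n) (u : Fin p), (learnTime p n X (tauStar d α β h) u : ℝ) ≤
        800 * ellStar d α β h * (sampleCoeff d α β h * (1 + 2 * Real.log (1 / ζ)) + 2) *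
          (p * Real.log p) := by
      intro X u
      refine (learnTime_le hd hα hαβ hh
        (one_le_of_sampleBound_le hd hα hαβ hh hζ hζ1 (by omega) hbound) X u).trans ?_
      have h1 := ceil_sampleBound_le (d := d) hd hα hαβ hh hζ hζ1 hp
      rw [← hn] at h1
      have h2 := mul_le_mul_of_nonneg_left h1
        (by positivity : 0 ≤ 800 * ellStar d α β h * (p : ℝ))
      linarith
    refine (prob_correct hG hθ hd hα hαβ hh hζ hbound).trans (measureReal_mono fun X hX => ?_)
    refine ⟨fun u => ⟨hX u, htime X u⟩, (Finset.sum_le_sum fun u _ => htime X u).trans_eq ?_⟩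
    rw [Finset.sum_const, Finset.card_univ, Fintype.card_fin, nsmul_eq_mul]
    ring
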